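/- Let $\mathbb Z[\delta^{\pm1}]$ be the Laurent polynomial ring in one variable $\delta$. For a graph $Q$, the simply laced Brauer algebra $\mathrm{Br}(Q)$ is the unital associative $\mathbb Z[\delta^{\pm1}]$-algebra with generators $R_i,E_i$ ($i$ a node of $Q$) and the relations $$R_i^2=1,\qquad R_iE_i=E_iR_i=E_i,\qquad E_i^2=\delta E_i$$ for all $i$; $$R_iR_j=R_jR_i,\qquad E_iR_j=R_jE_i,\qquad E_iE_j=E_jE_i$$ for $i\neq j$ not adjacent; and $$R_iR_jR_i=R_jR_iR_j,\qquad R_jR_iE_j=E_iE_j,\qquad R_iE_jR_i=R_jE_iR_j$$ for $i,j$ adjacent. Let $\mathrm{Br}(\mathrm D_6)$ be this algebra for the Dynkin diagram $\mathrm D_6$ with nodes $1,\dots,6$ and edges $1-3$, $2-3$, $3-4$, $4-5$, $5-6$. Let $\mathrm{Br}(\mathrm H_3)$ be the unital associative $\mathbb Z[\delta^{\pm1}]$-algebra with generators $r_1,r_2,r_3,e_1,e_2,e_3$ and the following relations. For all $i$: $r_i^2=1$, $r_ie_i=e_ir_i=e_i$ and $e_i^2=\delta^2e_i$. For $\{i,j\}=\{1,3\}$: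 $r_ir_j=r_jr_i$, $e_ir_j=r_je_i$ and $e_ie_j=e_je_i$. For $\{i,j\}=\{2,3\}$: $r_ir_jr_i=r_jr_ir_j$, $r_jr_ie_j=e_ie_j$ and $r_ie_jr_i=r_je_ir_j$. Finally, $$r_1r_2r_1r_2r_1=r_2r_1r_2r_1r_2,\qquad r_1r_2e_1r_2r_1=r_2r_1e_2r_1r_2,$$ $$e_1e_2e_1=e_1,\qquad e_1r_2e_1=e_1,\qquad e_1r_2r_1r_2e_1=e_1.$$ **Theorem.** There is a unique homomorphism of unital $\mathbb Z[\delta^{\pm1}]$-algebras $\varphi_1:\mathrm{Br}(\mathrm H_3)\to\mathrm{Br}(\mathrm D_6)$ with $$\varphi_1(r_1)=R_2R_4,\quad \varphi_1(r_2)=R_3R_5,\quad \varphi_1(r_3)=R_1R_6,$$ $$\varphi_1(e_1)=E_2E_4,\quad \varphi_1(e_2)=E_3E_5,\quad \varphi_1(e_3)=E_1E_6,$$ and $\varphi_1$ is injective. Moreover, $\mathrm{Br}(\mathrm H_3)$ is a free $\mathbb Z[\delta^{\pm1}]$-module of rank $1045$. -/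

import Mathlib

/-- The ground ring `ℤ[δ, δ⁻¹]`: the group algebra over `ℤ` of an infinite cyclic group. -/
abbrev ZDelta : Type := LaurentPolynomial ℤ

/-- The invertible indeterminate `δ`, the generator of the infinite cyclic group. -/
noncomputable def brauerDelta : ZDelta := LaurentPolynomial.T 1

/-- Symbols for the generators of a Brauer algebra with node set `V`: a Coxeter generator `r i`
and a Temperley-Lieb generator `e i` for each node `i`. -/
inductive BrauerGen (V : Type) : Type
  | r (i : V) : BrauerGen V
  | e (i : V) : BrauerGen V

/-- The free unital associative `ℤ[δ, δ⁻¹]`-algebra on the generators. The relations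
`δ δ⁻¹ = 1` and `δ x = x δ` are built into it. -/
abbrev BrauerFree (V : Type) : Type := FreeAlgebra ZDelta (BrauerGen V)

/-- The generator `r i` in the free algebra. -/
noncomputable def freeR {V : Type} (i : V) : BrauerFree V :=
  FreeAlgebra.ι ZDelta (BrauerGen.r i)

/-- The generator `e i` in the free algebra. -/
noncomputable def freeE {V : Type} (i : V) : BrauerFree V :=
  FreeAlgebra.ι ZDelta (BrauerGen.e i)

/-- The relations common to all the Brauer algebras below. Here `bond i j` means that `i` and `j`
are joined by a simple bond, `noBond i j` that `i` and `j` are distinct and not joined by any bond,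
and `c` is the parameter of the relation `e i * e i = c • e i`. -/
inductive BrauerRel {V : Type} (bond noBond : V → V → Prop) (c : ZDelta) :
    BrauerFree V → BrauerFree V → Prop
  | r_sq (i : V) : BrauerRel bond noBond c (freeR i * freeR i) 1
  | r_e (i : V) : BrauerRel bond noBond c (freeR i * freeE i) (freeE i)
  | e_r (i : V) : BrauerRel bond noBond c (freeE i * freeR i) (freeE i)
  | e_sq (i : V) : BrauerRel bond noBond c (freeE i * freeE i) (c • freeE i)
  | r_comm (i j : V) (h : noBond i j) :
      BrauerRel bond noBond c (freeR i * freeR j) (freeR j * freeR i)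
  | e_r_comm (i j : V) (h : noBond i j) :
      BrauerRel bond noBond c (freeE i * freeR j) (freeR j * freeE i)
  | e_comm (i j : V) (h : noBond i j) :
      BrauerRel bond noBond c (freeE i * freeE j) (freeE j * freeE i)
  | braid (i j : V) (h : bond i j) :
      BrauerRel bond noBond c (freeR i * freeR j * freeR i) (freeR j * freeR i * freeR j)
  | r_r_e (i j : V) (h : bond i j) :
      BrauerRel bond noBond c (freeR j * freeR i * freeE j) (freeE i * freeE j)
  | r_e_r (i j : V) (h : bond i j) :
      BrauerRel bond noBond c (freeR i * freeE j * freeR i) (freeR j * freeE i * freeR j)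

/-- The simply laced Brauer algebra `Br(Q)` of a graph `Q`, with `e i * e i = δ • e i`. -/
abbrev SimplyLacedBrauerAlgebra {V : Type} (Q : SimpleGraph V) : Type :=
  RingQuot (BrauerRel Q.Adj (fun i j => i ≠ j ∧ ¬ Q.Adj i j) brauerDelta)

namespace SimplyLacedBrauerAlgebra

/-- The Coxeter generator `R i` of `Br(Q)`. -/
noncomputable def R {V : Type} (Q : SimpleGraph V) (i : V) : SimplyLacedBrauerAlgebra Q :=
  RingQuot.mkAlgHom ZDelta _ (freeR i)

/-- The Temperley-Lieb generator `E i` of `Br(Q)`. -/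
noncomputable def E {V : Type} (Q : SimpleGraph V) (i : V) : SimplyLacedBrauerAlgebra Q :=
  RingQuot.mkAlgHom ZDelta _ (freeE i)

end SimplyLacedBrauerAlgebra

/-- The Dynkin diagram of type `D₆`. The node `i : Fin 6` is the node usually numbered `i + 1`:
in the numbering by `1, …, 6` the edges are `1 - 3`, `2 - 3`, `3 - 4`, `4 - 5`, `5 - 6`. -/
def graphD6 : SimpleGraph (Fin 6) :=
  SimpleGraph.fromEdgeSet {s(0, 2), s(1, 2), s(2, 3), s(3, 4), s(4, 5)}

/-- The Brauer algebra of type `D₆`. -/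
abbrev BrD6 : Type := SimplyLacedBrauerAlgebra graphD6

namespace BrD6

/-- `BrD6.R i` is the generator usually written `R_{i+1}`. -/
noncomputable def R (i : Fin 6) : BrD6 := SimplyLacedBrauerAlgebra.R graphD6 i

/-- `BrD6.E i` is the generator usually written `E_{i+1}`. -/
noncomputable def E (i : Fin 6) : BrD6 := SimplyLacedBrauerAlgebra.E graphD6 i

end BrD6

/-- The Coxeter matrix of type `H₃`. The node `i : Fin 3` is the node usually numbered `i + 1`:
in the numbering by `1, 2, 3` the bond `1 - 2` has label `5` and the bond `2 - 3` is simple.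
(This is Mathlib's `CoxeterMatrix.H₃` with the nodes in the opposite order.) -/
def coxeterH3 : CoxeterMatrix (Fin 3) where
  M := !![1, 5, 2;
          5, 1, 3;
          2, 3, 1]
  off_diagonal := by intro i j; fin_cases i <;> fin_cases j <;> simp

/-- The defining relations of the Brauer algebra of type `H₃`: the common ones, with
`e i * e i = δ ^ 2 • e i`, and those for the bond with label `5` between the first two nodes. -/
inductive BrH3Rel : BrauerFree (Fin 3) → BrauerFree (Fin 3) → Prop
  | common (x y : BrauerFree (Fin 3))
      (h : BrauerRel (fun i j => coxeterH3 i j = 3) (fun i j => coxeterH3 i j = 2)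
        (brauerDelta ^ 2) x y) : BrH3Rel x y
  | braid5 : BrH3Rel (freeR 0 * freeR 1 * freeR 0 * freeR 1 * freeR 0)
      (freeR 1 * freeR 0 * freeR 1 * freeR 0 * freeR 1)
  | conj5 : BrH3Rel (freeR 0 * freeR 1 * freeE 0 * freeR 1 * freeR 0)
      (freeR 1 * freeR 0 * freeE 1 * freeR 0 * freeR 1)
  | e_e_e : BrH3Rel (freeE 0 * freeE 1 * freeE 0) (freeE 0)
  | e_r_e : BrH3Rel (freeE 0 * freeR 1 * freeE 0) (freeE 0)
  | e_rrr_e : BrH3Rel (freeE 0 * freeR 1 * freeR 0 * freeR 1 * freeE 0) (freeE 0)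

/-- The Brauer algebra of type `H₃`. -/
abbrev BrH3 : Type := RingQuot BrH3Rel

namespace BrH3

/-- `BrH3.r i` is the generator usually written `r_{i+1}`. -/
noncomputable def r (i : Fin 3) : BrH3 := RingQuot.mkAlgHom ZDelta BrH3Rel (freeR i)

/-- `BrH3.e i` is the generator usually written `e_{i+1}`. -/
noncomputable def e (i : Fin 3) : BrH3 := RingQuot.mkAlgHom ZDelta BrH3Rel (freeE i)

end BrH3

/-- The prescribed images of the generators: the homomorphism `φ` sends
`r₁, r₂, r₃, e₁, e₂, e₃` to `R₂R₄, R₃R₅, R₁R₆, E₂E₄, E₃E₅, E₁E₆` respectively. -/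
def HasPrescribedImages (φ : BrH3 →ₐ[ZDelta] BrD6) : Prop :=
  φ (BrH3.r 0) = BrD6.R 1 * BrD6.R 3 ∧
  φ (BrH3.r 1) = BrD6.R 2 * BrD6.R 4 ∧
  φ (BrH3.r 2) = BrD6.R 0 * BrD6.R 5 ∧
  φ (BrH3.e 0) = BrD6.E 1 * BrD6.E 3 ∧
  φ (BrH3.e 1) = BrD6.E 2 * BrD6.E 4 ∧
  φ (BrH3.e 2) = BrD6.E 0 * BrD6.E 5

/-! The products of two commuting generators of `Br(D₆)` prescribed as images satisfy the relations
of `Br(H₃)`, which gives `BrD6.fold`; it is unique because its values on generators are fixed. The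
rest compares two bounds: 1045 monomials span `Br(H₃)` (`BrH3.span_monomial`), and their images in
`Br(D₆)` are linearly independent (`BrH3.linearIndependent_fold_monomial`). Together these give a
basis and injectivity.

Spanning. The Coxeter group `W` has order 120. Its 15 reflections are conjugate, with centralizers
of order 8, and it permutes transitively 5 triples of mutually orthogonal reflections, with
stabilizers of order 24. Every `e i` is conjugate to `e 0`, and sandwiching a group element between
two copies of `e 0` gives, up to scalars and group elements, `e 0` or `f = e 0 * e 2`. So the
algebra is spanned by group elements and their two-sided multiples of `e 0` and `f`. Now `e 0`
absorbs `s 0` and commutes with the Klein four-group `n`, while `f` absorbs the stabilizer of a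
triple. This leaves 120 + 15·4·15 + 5·5 monomials.

Independence. `Br(D₆)` acts on Brauer diagrams, that is, matchings of two rows of six points, in two
versions. With signs attached to the edges, a loop of negative sign is zero; the generators at the
two short ends of the fork join the same points with opposite signs, so their product, and with it
`f`, acts as zero. Without signs these two generators act alike, and their product is `δ` times
either. Applied to the identity diagram, the signed version sends the 1020 monomials without `f` to
distinct diagrams and kills the others; the unsigned version sends the remaining 25 to `δ` times
distinct diagrams. Since `δ` is a unit, the system is triangular. Diagrams are told apart by their
horizontal edges, which record a conjugate of a reflection or of a triple in each row. -/

/-! ### The Coxeter group of type `H₃` and its coset representatives -/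

namespace H3

/-- The Coxeter group of type `H₃`. -/
abbrev W : Type := coxeterH3.Group

/-- The simple reflections of `W`. -/
noncomputable def s (i : Fin 3) : W := coxeterH3.simple i

theorem s_pow (i j : Fin 3) : (s i * s j) ^ coxeterH3 i j = 1 :=
  coxeterH3.toCoxeterSystem.simple_mul_simple_pow i j

theorem s_sq (i : Fin 3) : s i * s i = 1 := by
  have h := s_pow i i
  rwa [coxeterH3.diagonal, pow_one] at h

theorem s_inv (i : Fin 3) : (s i)⁻¹ = s i := inv_eq_of_mul_eq_one_left (s_sq i)

theorem s_comm : s 2 * s 0 = s 0 * s 2 := by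
  have h : (s 2 * s 0) ^ 2 = 1 := s_pow 2 0
  rw [sq] at h
  simpa [s_inv] using eq_inv_of_mul_eq_one_left h

theorem s_braid3 : s 2 * (s 1 * s 2) = s 1 * (s 2 * s 1) := by
  have h : (s 2 * s 1) ^ 3 = 1 := s_pow 2 1
  have h' : (s 2 * (s 1 * s 2)) * (s 1 * (s 2 * s 1)) = 1 := by
    rw [← h]; simp only [pow_succ, pow_zero, one_mul, mul_assoc]
  simpa [s_inv, mul_assoc] using eq_inv_of_mul_eq_one_left h'

theorem s_braid5 :
    s 1 * (s 0 * (s 1 * (s 0 * s 1))) = s 0 * (s 1 * (s 0 * (s 1 * s 0))) := by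
  have h : (s 1 * s 0) ^ 5 = 1 := s_pow 1 0
  have h' : (s 1 * (s 0 * (s 1 * (s 0 * s 1)))) * (s 0 * (s 1 * (s 0 * (s 1 * s 0)))) = 1 := by
    rw [← h]; simp only [pow_succ, pow_zero, one_mul, mul_assoc]
  simpa [s_inv, mul_assoc] using eq_inv_of_mul_eq_one_left h'

theorem s_sq_mul (i : Fin 3) (x : W) : s i * (s i * x) = x := by
  rw [← mul_assoc, s_sq, one_mul]

theorem s_comm_mul (x : W) : s 2 * (s 0 * x) = s 0 * (s 2 * x) := by
  rw [← mul_assoc, s_comm, mul_assoc]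

theorem s_braid3_mul (x : W) : s 2 * (s 1 * (s 2 * x)) = s 1 * (s 2 * (s 1 * x)) := by
  simpa only [mul_assoc] using congrArg (· * x) s_braid3

theorem s_braid5_mul (x : W) : s 1 * (s 0 * (s 1 * (s 0 * (s 1 * x)))) =
    s 0 * (s 1 * (s 0 * (s 1 * (s 0 * x)))) := by
  simpa only [mul_assoc] using congrArg (· * x) s_braid5

theorem s_braid3_comm_mul (x : W) :
    s 2 * (s 1 * (s 0 * (s 2 * x))) = s 1 * (s 2 * (s 1 * (s 0 * x))) := by
  rw [← s_comm_mul, s_braid3_mul]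

/-- A critical pair: the word with indices 2, 1, 0, 2, 1, 2 reduces from either end. With the braid
rules and `s_rewrite10_mul` it lets `simp` normalize the words in the coset computations. -/
theorem s_rewrite6_mul (x : W) : s 2 * (s 1 * (s 0 * (s 1 * (s 2 * (s 1 * x))))) =
    s 1 * (s 2 * (s 1 * (s 0 * (s 1 * (s 2 * x))))) := by
  rw [← s_braid3_comm_mul, s_braid3_mul]

theorem s_rewrite6 : s 2 * (s 1 * (s 0 * (s 1 * (s 2 * s 1)))) =
    s 1 * (s 2 * (s 1 * (s 0 * (s 1 * s 2)))) := by
  simpa using s_rewrite6_mul 1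

/-- The critical pair of `s_rewrite6_mul` with the braid relation of length five. -/
theorem s_rewrite10_mul (x : W) :
    s 2 * (s 1 * (s 0 * (s 1 * (s 0 * (s 2 * (s 1 * (s 0 * (s 1 * (s 0 * x))))))))) =
    s 1 * (s 2 * (s 1 * (s 0 * (s 1 * (s 0 * (s 2 * (s 1 * (s 0 * (s 1 * x))))))))) := by
  have h := s_rewrite6_mul (s 0 * (s 1 * (s 0 * (s 1 * x))))
  rw [s_braid5_mul, s_comm_mul, s_comm_mul] at h
  exact h

theorem s_rewrite10 :
    s 2 * (s 1 * (s 0 * (s 1 * (s 0 * (s 2 * (s 1 * (s 0 * (s 1 * s 0)))))))) =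
    s 1 * (s 2 * (s 1 * (s 0 * (s 1 * (s 0 * (s 2 * (s 1 * (s 0 * s 1)))))))) := by
  simpa using s_rewrite10_mul 1

/-- Conjugation by `p` takes `s 0` to `s 2`. -/
noncomputable def p : W := s 1 * (s 0 * (s 2 * (s 1 * (s 0 * s 1))))

/-- The third reflection orthogonal to `s 0` and `s 2`. -/
noncomputable def t : W := p⁻¹ * s 0 * p

/-- A reflection that generates with `s 0` a dihedral group of order 6. -/
noncomputable def d : W := s 1 * (s 0 * (s 1 * (s 2 * (s 1 * (s 0 * s 1)))))

/-- Representatives of the cosets of the reflection subgroup `⟨s 0⟩` in the centralizer of `s 0`. -/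
noncomputable def n : Fin 4 → W := ![1, s 2, t, s 2 * t]

/-- Representatives of the cosets of the centralizer of `s 0`. -/
noncomputable def u : Fin 15 → W :=
  ![1, p, p⁻¹, s 1, s 0 * s 1, s 2 * s 1, s 0 * (s 2 * s 1),
    s 1 * (s 0 * s 1), s 0 * (s 1 * (s 0 * s 1)), s 2 * (s 1 * (s 0 * s 1)),
    s 0 * (s 2 * (s 1 * (s 0 * s 1))),
    d, s 0 * d, s 2 * d, s 0 * (s 2 * d)]

/-- Representatives of the cosets of the stabilizer of a triple of orthogonal reflections. -/
noncomputable def v : Fin 5 → W := ![1, s 1, s 0 * s 1, s 2 * s 1, s 1 * (s 0 * s 1)]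

theorem p_inv : p⁻¹ = s 1 * (s 0 * (s 1 * (s 0 * (s 2 * s 1)))) := by
  simp only [p, mul_inv_rev, s_inv, mul_assoc, s_comm_mul]

theorem t_eq : t = s 1 * (s 0 * (s 1 * (s 0 * (s 2 * (s 1 * (s 0 * (s 1 * (s 0 * (s 2 *
    (s 1 * (s 0 * s 1))))))))))) := by
  rw [t, p_inv]
  simp only [p, mul_assoc]

theorem t_sq : t * t = 1 := by
  have h := s_sq 0
  calc t * t = p⁻¹ * (s 0 * s 0) * p := by rw [t]; group
    _ = 1 := by rw [h]; group

theorem t_comm_zero : t * s 0 = s 0 * t := by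
  simp only [t_eq, mul_assoc, s_rewrite10, s_braid5_mul]

theorem t_comm_two : t * s 2 = s 2 * t := by
  simp only [t_eq, mul_assoc, s_comm_mul, s_braid5_mul, s_rewrite6, s_rewrite6_mul, s_rewrite10_mul]

theorem n_mul_n (i j : Fin 4) : ∃ k, n i * n j = n k := by
  have h := t_comm_two
  have h' := fun x => congrArg (· * x) t_comm_two
  simp only [mul_assoc] at h'
  -- The multiplication table of the Klein four-group generated by `s 2` and `t`.
  refine ⟨(![![0, 1, 2, 3], ![1, 0, 3, 2], ![2, 3, 0, 1], ![3, 2, 1, 0]] :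
    Fin 4 → Fin 4 → Fin 4) i j, ?_⟩
  fin_cases i <;> fin_cases j <;> simp [n, mul_assoc, h, h', s_sq, s_sq_mul, t_sq]

theorem n_comm_zero (i : Fin 4) : Commute (n i) (s 0) := by
  have h2 : Commute (s 2) (s 0) := s_comm
  have ht : Commute t (s 0) := t_comm_zero
  fin_cases i
  exacts [Commute.one_left _, h2, ht, h2.mul_left ht]

/-- The action of the simple reflections on the cosets of the centralizer of `s 0`. -/
theorem s_mul_u (i : Fin 3) (j : Fin 15) : ∃ j' k l, s i * u j = u j' * (s 0 ^ k * n l) := by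
  -- The tables give `j'`, `k` and `l`. The first is the conjugation action on the fifteen
  -- reflections. Columns 1 and 2 show that conjugation by `p` cycles `s 0`, `s 2`, `t`.
  refine ⟨(![![0, 1, 2, 4, 3, 6, 5, 8, 7, 10, 9, 12, 11, 14, 13],
    ![3, 10, 13, 0, 7, 5, 14, 4, 8, 12, 1, 11, 9, 2, 6],
    ![0, 1, 2, 5, 6, 3, 4, 9, 10, 7, 8, 13, 14, 11, 12]] : Fin 3 → Fin 15 → Fin 15) i j,
    (![![1, 0, 0, 0, 0, 0, 0, 0, 0, 0, 0, 0, 0, 0, 0],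
    ![0, 0, 0, 0, 0, 0, 0, 0, 1, 0, 0, 0, 0, 0, 0],
    ![0, 1, 0, 0, 0, 0, 0, 0, 0, 0, 0, 0, 0, 0, 0]] : Fin 3 → Fin 15 → ℕ) i j,
    (![![0, 2, 1, 0, 0, 0, 0, 0, 0, 0, 0, 0, 0, 0, 0],
    ![0, 0, 2, 0, 0, 1, 2, 0, 0, 2, 0, 2, 2, 2, 2],
    ![1, 0, 2, 0, 0, 0, 0, 0, 0, 0, 0, 0, 0, 0, 0]] : Fin 3 → Fin 15 → Fin 4) i j, ?_⟩
  fin_cases i <;> fin_cases j <;>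
    simp [u, n, d, p, t_eq, mul_assoc, s_inv, s_sq, s_comm_mul, s_braid3, s_braid3_mul,
      s_braid5, s_braid5_mul, s_braid3_comm_mul, s_rewrite6, s_rewrite6_mul, s_rewrite10_mul, s_sq_mul]

@[elab_as_elim]
theorem induction_left {P : W → Prop} (w : W) (one : P 1)
    (mul : ∀ (i : Fin 3) (w : W), P w → P (s i * w)) : P w :=
  coxeterH3.toCoxeterSystem.simple_induction_left w one fun w i => mul i w

/-- These products include 1 and are stable under left multiplication by simple reflections: by
`s_mul_u` only factors from the centralizer of `s 0` appear, and these multiply among themselves. -/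
theorem exists_eq_u_mul (w : W) : ∃ j k l, w = u j * (s 0 ^ k * n l) := by
  induction w using induction_left with
  | one => exact ⟨0, 0, 0, by simp [u, n]⟩
  | mul i w h =>
    obtain ⟨j, k, l, rfl⟩ := h
    obtain ⟨j', k', l', h⟩ := s_mul_u i j
    obtain ⟨m, hm⟩ := n_mul_n l' l
    refine ⟨j', k' + k, m, ?_⟩
    rw [← mul_assoc, h, ← hm, pow_add]
    simp only [mul_assoc]
    rw [← mul_assoc (n l') (s 0 ^ k), ((n_comm_zero l').pow_right k).eq, mul_assoc]

theorem exists_s_zero_pow (k : ℕ) : ∃ i : Fin 2, s 0 ^ k = s 0 ^ (i : ℕ) := by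
  refine ⟨⟨k % 2, Nat.mod_lt _ two_pos⟩, ?_⟩
  conv_lhs => rw [← Nat.mod_add_div k 2, pow_add, pow_mul, sq, s_sq, one_pow, mul_one]

end H3

/-! ### Spanning monomials of the Brauer algebra of type `H₃` -/

namespace BrH3

theorem rel {x y : BrauerFree (Fin 3)} (h : BrH3Rel x y) :
    RingQuot.mkAlgHom ZDelta BrH3Rel x = RingQuot.mkAlgHom ZDelta BrH3Rel y :=
  RingQuot.mkAlgHom_rel ZDelta h

theorem r_sq (i : Fin 3) : r i * r i = 1 := by
  simpa [r, e] using rel (.common _ _ (.r_sq i))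

theorem r_e (i : Fin 3) : r i * e i = e i := by
  simpa [r, e] using rel (.common _ _ (.r_e i))

theorem e_r (i : Fin 3) : e i * r i = e i := by
  simpa [r, e] using rel (.common _ _ (.e_r i))

theorem e_sq (i : Fin 3) : e i * e i = brauerDelta ^ 2 • e i := by
  simpa [r, e] using rel (.common _ _ (.e_sq i))

theorem r_comm {i j : Fin 3} (h : coxeterH3 i j = 2) : r i * r j = r j * r i := by
  simpa [r, e] using rel (.common _ _ (.r_comm i j h))

theorem e_r_comm {i j : Fin 3} (h : coxeterH3 i j = 2) : e i * r j = r j * e i := by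
  simpa [r, e] using rel (.common _ _ (.e_r_comm i j h))

theorem e_comm {i j : Fin 3} (h : coxeterH3 i j = 2) : e i * e j = e j * e i := by
  simpa [r, e] using rel (.common _ _ (.e_comm i j h))

theorem r_braid {i j : Fin 3} (h : coxeterH3 i j = 3) : r i * r j * r i = r j * r i * r j := by
  simpa [r, e] using rel (.common _ _ (.braid i j h))

theorem r_r_e {i j : Fin 3} (h : coxeterH3 i j = 3) : r j * r i * e j = e i * e j := by
  simpa [r, e] using rel (.common _ _ (.r_r_e i j h))

theorem r_e_r {i j : Fin 3} (h : coxeterH3 i j = 3) : r i * e j * r i = r j * e i * r j := by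
  simpa [r, e] using rel (.common _ _ (.r_e_r i j h))

theorem r_braid5 : r 0 * r 1 * r 0 * r 1 * r 0 = r 1 * r 0 * r 1 * r 0 * r 1 := by
  simpa [r, e] using rel .braid5

theorem r_conj5 : r 0 * r 1 * e 0 * r 1 * r 0 = r 1 * r 0 * e 1 * r 0 * r 1 := by
  simpa [r, e] using rel .conj5

theorem e_r_e_zero : e 0 * r 1 * e 0 = e 0 := by
  simpa [r, e] using rel .e_r_e

theorem e_rrr_e_zero : e 0 * r 1 * r 0 * r 1 * e 0 = e 0 := by
  simpa [r, e] using rel .e_rrr_e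

theorem r_r_mul (i : Fin 3) (x : BrH3) : r i * (r i * x) = x := by
  rw [← mul_assoc, r_sq, one_mul]

theorem isLiftable_r : coxeterH3.IsLiftable r := by
  have two {i j : Fin 3} (h : coxeterH3 i j = 2) : (r i * r j) ^ 2 = 1 := by
    rw [sq, mul_assoc, r_comm h, r_r_mul, r_sq]
  have three {i j : Fin 3} (h : coxeterH3 i j = 3) : (r i * r j) ^ 3 = 1 := by
    calc (r i * r j) ^ 3 = (r i * r j * r i) * (r j * r i * r j) := by noncomm_ring
      _ = 1 := by rw [r_braid h]; simp only [mul_assoc, r_r_mul, r_sq]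
  have h5 := r_braid5
  simp only [mul_assoc] at h5
  intro i j
  fin_cases i <;> fin_cases j
  · exact (pow_one _).trans (r_sq _)
  · calc (r 0 * r 1) ^ 5 = (r 0 * (r 1 * (r 0 * (r 1 * r 0)))) *
          (r 1 * (r 0 * (r 1 * (r 0 * r 1)))) := by noncomm_ring
      _ = 1 := by rw [h5]; simp only [mul_assoc, r_r_mul, r_sq]
  · exact two rfl
  · calc (r 1 * r 0) ^ 5 = (r 1 * (r 0 * (r 1 * (r 0 * r 1)))) *
          (r 0 * (r 1 * (r 0 * (r 1 * r 0)))) := by noncomm_ring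
      _ = 1 := by rw [h5]; simp only [mul_assoc, r_r_mul, r_sq]
  · exact (pow_one _).trans (r_sq _)
  · exact three rfl
  · exact two rfl
  · exact three rfl
  · exact (pow_one _).trans (r_sq _)

/-- The homomorphism from the Coxeter group of type `H₃` to the Brauer algebra. -/
noncomputable def ω : H3.W →* BrH3 := coxeterH3.toCoxeterSystem.lift ⟨r, isLiftable_r⟩

@[simp]
theorem ω_s (i : Fin 3) : ω (H3.s i) = r i :=
  coxeterH3.toCoxeterSystem.lift_apply_simple isLiftable_r i

theorem ω_mul_inv (g : H3.W) : ω g * ω g⁻¹ = 1 := by rw [← map_mul, mul_inv_cancel, map_one]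

theorem ω_inv_mul (g : H3.W) : ω g⁻¹ * ω g = 1 := by rw [← map_mul, inv_mul_cancel, map_one]

theorem r_r_e' {i j : Fin 3} (h : coxeterH3 i j = 3) : e j * r i * r j = r i * r j * e i := by
  have h1 := congrArg (fun x => r i * x * r j) (r_e_r h)
  simpa only [mul_assoc, r_r_mul, r_sq, mul_one] using h1

/-- Not a defining relation for a simple bond: insert `r i` after the first `e i` and apply `r_r_e`
three times. -/
theorem e_r_e_of_bond {i j : Fin 3} (h : coxeterH3 i j = 3) : e i * r j * e i = e i := by
  have h' : coxeterH3 j i = 3 := by rw [coxeterH3.symmetric]; exact h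
  calc e i * r j * e i = e i * r i * r j * e i := by rw [e_r]
    _ = e i * (r i * r j * e i) := by simp only [mul_assoc]
    _ = (e i * e j) * e i := by rw [r_r_e h']; simp only [mul_assoc]
    _ = r j * r i * (e j * e i) := by rw [← r_r_e h]; simp only [mul_assoc]
    _ = e i := by rw [← r_r_e h']; simp only [mul_assoc, r_r_mul]

theorem e_one_mul : e 1 * (r 0 * r 1 * r 0 * r 1) = r 0 * r 1 * r 0 * r 1 * e 0 := by
  have h := congrArg (fun x => r 0 * r 1 * x * (r 0 * r 1)) r_conj5
  simpa only [mul_assoc, r_r_mul, r_sq, mul_one] using h.symm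

theorem e_one_eq : e 1 = r 0 * r 1 * r 0 * r 1 * e 0 * (r 1 * r 0 * r 1 * r 0) := by
  rw [← e_one_mul]
  simp only [mul_assoc, r_r_mul, r_sq, mul_one]

/-- Up to commuting `r 0` with `r 2`, the word `p` first carries `e 0` across the 5-bond to `e 1`
and then across the simple bond to `e 2`. -/
theorem ω_p_mul_e : ω H3.p * e 0 = e 2 * ω H3.p := by
  have hp : ω H3.p = r 1 * r 2 * (r 0 * r 1 * r 0 * r 1) := by
    simp only [H3.p, ← H3.s_comm_mul, map_mul, ω_s, mul_assoc]
  rw [hp, mul_assoc, ← e_one_mul, ← mul_assoc, ← r_r_e' rfl]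
  simp only [mul_assoc]

theorem ω_p_inv_mul_e : ω H3.p⁻¹ * e 2 = e 0 * ω H3.p⁻¹ := by
  calc ω H3.p⁻¹ * e 2 = ω H3.p⁻¹ * (e 2 * ω H3.p) * ω H3.p⁻¹ := by
        simp only [mul_assoc, ω_mul_inv, mul_one]
    _ = (ω H3.p⁻¹ * ω H3.p) * e 0 * ω H3.p⁻¹ := by rw [← ω_p_mul_e]; simp only [mul_assoc]
    _ = e 0 * ω H3.p⁻¹ := by rw [ω_inv_mul, one_mul]

theorem commute_e_r_two : Commute (e 0) (r 2) := e_r_comm rfl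

/-- Since `t` is the conjugate of `s 0` by `p⁻¹`, moving `e 0` past `p⁻¹` turns it into `e 2`, which
commutes with `r 0` and turns back at `p`. -/
theorem commute_e_t : Commute (e 0) (ω H3.t) := by
  have h : e 2 * r 0 = r 0 * e 2 := e_r_comm rfl
  have h0 := ω_p_mul_e
  have h1 := ω_p_inv_mul_e
  change e 0 * ω H3.t = ω H3.t * e 0
  simp only [H3.t, map_mul, ω_s]
  calc e 0 * (ω H3.p⁻¹ * r 0 * ω H3.p) = (e 0 * ω H3.p⁻¹) * r 0 * ω H3.p := by
        simp only [mul_assoc]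
    _ = ω H3.p⁻¹ * (e 2 * r 0) * ω H3.p := by rw [← h1]; simp only [mul_assoc]
    _ = ω H3.p⁻¹ * r 0 * (e 2 * ω H3.p) := by rw [h]; simp only [mul_assoc]
    _ = _ := by rw [← h0]; simp only [mul_assoc]

theorem commute_e_n (l : Fin 4) : Commute (e 0) (ω (H3.n l)) := by
  have h2 : Commute (e 0) (ω (H3.s 2)) := by rw [ω_s]; exact commute_e_r_two
  have ht := commute_e_t
  fin_cases l
  · change Commute (e 0) (ω 1)
    rw [map_one]; exact .one_right _
  · exact h2
  · exact ht
  · change Commute (e 0) (ω (H3.s 2 * H3.t))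
    rw [map_mul]; exact h2.mul_right ht

theorem e_mul_s_pow (k : ℕ) : e 0 * ω (H3.s 0 ^ k) = e 0 := by
  induction k with
  | zero => simp
  | succ k ih => rw [pow_succ, map_mul, ← mul_assoc, ih, ω_s, e_r]

theorem s_pow_mul_e (k : ℕ) : ω (H3.s 0 ^ k) * e 0 = e 0 := by
  induction k with
  | zero => simp
  | succ k ih => rw [pow_succ, map_mul, mul_assoc, ω_s, r_e, ih]

/-- The product of two generators `e` that commute. -/
noncomputable def f : BrH3 := e 0 * e 2

theorem f_eq : f = e 2 * e 0 := e_comm rfl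

theorem e_zero_mul_f : e 0 * f = brauerDelta ^ 2 • f := by
  rw [f, ← mul_assoc, e_sq, smul_mul_assoc]

theorem r_zero_mul_f : r 0 * f = f := by rw [f, ← mul_assoc, r_e]

theorem r_two_mul_f : r 2 * f = f := by rw [f_eq, ← mul_assoc, r_e]

theorem f_mul_r_zero : f * r 0 = f := by rw [f_eq, mul_assoc, e_r]

theorem f_mul_r_two : f * r 2 = f := by rw [f, mul_assoc, e_r]

theorem e_r_f : e 0 * r 1 * f = f := by
  rw [f, ← mul_assoc, e_r_e_zero]

theorem e_rrr_f : e 0 * r 1 * r 0 * r 1 * f = f := by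
  rw [f, ← mul_assoc, e_rrr_e_zero]

theorem f_rrr_e : f * r 1 * r 0 * r 1 * e 0 = f := by
  calc f * r 1 * r 0 * r 1 * e 0 = e 2 * (e 0 * r 1 * r 0 * r 1 * e 0) := by
        rw [f_eq]; simp only [mul_assoc]
    _ = f := by rw [e_rrr_e_zero, f_eq]

theorem e_one_mul_f : e 1 * f = r 2 * r 1 * f := by
  rw [f_eq, ← mul_assoc, ← mul_assoc, r_r_e rfl]

theorem f_mul_e_one : f * e 1 = f * r 1 * r 2 := by
  have h : e 2 * e 1 = r 1 * r 2 * e 1 := (r_r_e rfl).symm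
  rw [f, mul_assoc, mul_assoc, mul_assoc, h, ← r_r_e' rfl, mul_assoc]

/-- Compute `e 1 * f` twice: by the simple bond as `r 2 * r 1 * f`, and by writing `e 1` as a
conjugate of `e 0` and applying `e_rrr_f`. The two results differ by `p`. -/
theorem p_mul_f : ω H3.p * f = f := by
  have h : r 2 * r 1 * f = r 0 * r 1 * r 0 * r 1 * f := by
    calc r 2 * r 1 * f = e 1 * f := e_one_mul_f.symm
      _ = r 0 * r 1 * r 0 * r 1 * (e 0 * r 1 * r 0 * r 1 * (r 0 * f)) := by
          rw [e_one_eq]; simp only [mul_assoc]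
      _ = _ := by rw [r_zero_mul_f, e_rrr_f]
  have h' := congrArg (fun x => r 1 * r 2 * x) h
  simp only [mul_assoc, r_r_mul] at h'
  simp only [H3.p, ← H3.s_comm_mul, map_mul, ω_s, mul_assoc]
  exact h'.symm

theorem f_mul_p_inv : f * ω H3.p⁻¹ = f := by
  have h : f * r 1 * r 2 = f * r 1 * r 0 * r 1 * r 0 := by
    calc f * r 1 * r 2 = f * e 1 := f_mul_e_one.symm
      _ = (f * r 0) * r 1 * r 0 * r 1 * e 0 * (r 1 * r 0 * r 1 * r 0) := by
          rw [e_one_eq]; simp only [mul_assoc]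
      _ = _ := by rw [f_mul_r_zero, f_rrr_e]; simp only [mul_assoc]
  have h' := congrArg (fun x => x * (r 2 * r 1)) h
  simp only [mul_assoc, r_r_mul, r_sq, mul_one] at h'
  simp only [H3.p_inv, map_mul, ω_s]
  exact h'.symm

theorem r_two_r_zero_r_one_mul_f : r 2 * (r 0 * (r 1 * f)) = r 1 * (r 0 * (r 1 * f)) := by
  have h := congrArg (fun x => r 2 * (r 0 * (r 1 * x))) p_mul_f
  have hc : r 2 * (r 0 * (r 1 * (r 1 * (r 0 * (r 2 * (r 1 * (r 0 * (r 1 * f)))))))) =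
      r 1 * (r 0 * (r 1 * f)) := by
    simp only [r_r_mul]
  simp only [H3.p, map_mul, ω_s, mul_assoc] at h
  rw [← h, hc]

theorem f_mul_r_one_r_zero_r_two : f * r 1 * r 0 * r 2 = f * r 1 * r 0 * r 1 := by
  have h := congrArg (fun x => x * r 1 * r 0 * r 2) f_mul_p_inv
  have hc : f * ω H3.p⁻¹ * r 1 * r 0 * r 2 = f * r 1 * r 0 * r 1 := by
    simp only [H3.p_inv, ← H3.s_comm_mul, map_mul, ω_s, mul_assoc, r_sq, mul_one]
  rw [← hc, h]

/-- `f` absorbs `s 0`, `s 2` and `p`, which generate the stabilizer of the triple `s 0`, `s 2`, `t`,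
of index 5; the table in the proof is the action on the five triples. -/
theorem exists_ω_mul_f (g : H3.W) : ∃ m, ω g * f = ω (H3.v m) * f := by
  have h02 (x : BrH3) : r 2 * (r 0 * x) = r 0 * (r 2 * x) := by
    rw [← mul_assoc, r_comm (show coxeterH3 2 0 = 2 from rfl), mul_assoc]
  have hb (x : BrH3) : r 1 * (r 2 * (r 1 * x)) = r 2 * (r 1 * (r 2 * x)) := by
    simpa only [mul_assoc] using congrArg (· * x) (r_braid (show coxeterH3 1 2 = 3 from rfl))
  have h0 := r_zero_mul_f
  have h2 := r_two_mul_f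
  have hf := r_two_r_zero_r_one_mul_f
  have hf' : r 0 * (r 2 * (r 1 * f)) = r 1 * (r 0 * (r 1 * f)) := by rw [← h02, hf]
  have hf0 : r 0 * (r 1 * (r 0 * (r 1 * f))) = r 2 * (r 1 * f) := by rw [← hf', r_r_mul]
  have hf2 : r 2 * (r 1 * (r 0 * (r 1 * f))) = r 0 * (r 1 * f) := by rw [← hf, r_r_mul]
  induction g using H3.induction_left with
  | one => exact ⟨0, rfl⟩
  | mul i g ih =>
    obtain ⟨m, hm⟩ := ih
    refine ⟨(![![0, 2, 1, 4, 3], ![1, 0, 4, 3, 2], ![0, 3, 4, 1, 2]] :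
      Fin 3 → Fin 5 → Fin 5) i m, ?_⟩
    rw [map_mul, mul_assoc, hm, ω_s]
    fin_cases i <;> fin_cases m <;>
      simp [H3.v, mul_assoc, h0, h2, hb, hf, hf', hf0, hf2, r_r_mul]

theorem exists_f_mul_ω (g : H3.W) : ∃ m, f * ω g = f * ω (H3.v m)⁻¹ := by
  -- Left induction on `g⁻¹` makes the new letter a right factor of `f * ω g`.
  suffices h : ∃ m, f * ω (g⁻¹)⁻¹ = f * ω (H3.v m)⁻¹ by rwa [inv_inv] at h
  have h02 (x : BrH3) : x * r 0 * r 2 = x * r 2 * r 0 := by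
    rw [mul_assoc, r_comm (show coxeterH3 0 2 = 2 from rfl), mul_assoc]
  have hb (x : BrH3) : x * r 1 * r 2 * r 1 = x * r 2 * r 1 * r 2 := by
    simpa only [mul_assoc] using congrArg (x * ·) (r_braid (show coxeterH3 1 2 = 3 from rfl))
  have hr (i) (x : BrH3) : x * r i * r i = x := by rw [mul_assoc, r_sq, mul_one]
  have h0 := f_mul_r_zero
  have h2 := f_mul_r_two
  have hf := f_mul_r_one_r_zero_r_two
  have hf' : f * r 1 * r 2 * r 0 = f * r 1 * r 0 * r 1 := by rw [← h02, hf]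
  have hf0 : f * r 1 * r 0 * r 1 * r 0 = f * r 1 * r 2 := by rw [← hf', hr]
  have hf2 : f * r 1 * r 0 * r 1 * r 2 = f * r 1 * r 0 := by rw [← hf, hr]
  induction g⁻¹ using H3.induction_left with
  | one => exact ⟨0, rfl⟩
  | mul i g ih =>
    obtain ⟨m, hm⟩ := ih
    refine ⟨(![![0, 2, 1, 4, 3], ![1, 0, 4, 3, 2], ![0, 3, 4, 1, 2]] :
      Fin 3 → Fin 5 → Fin 5) i m, ?_⟩
    rw [mul_inv_rev, map_mul, ← mul_assoc, hm, H3.s_inv, ω_s]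
    fin_cases i <;> fin_cases m <;>
      simp [H3.v, H3.s_inv, ← mul_assoc, h0, h2, hb, hf, hf', hf0, hf2, hr]

/-- The monomials in the three two-sided cells. -/
def cellMonomials : Set BrH3 :=
  {x | ∃ g h, x = ω g ∨ x = ω g * e 0 * ω h ∨ x = ω g * f * ω h}

theorem ω_mul_mem {x : BrH3} (hx : x ∈ Submodule.span ZDelta cellMonomials) (g h : H3.W) :
    ω g * x * ω h ∈ Submodule.span ZDelta cellMonomials := by
  induction hx using Submodule.span_induction with
  | mem x hx =>
    apply Submodule.subset_span
    obtain ⟨a, b, rfl | rfl | rfl⟩ := hx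
    · exact ⟨g * a * h, 1, .inl (by simp only [map_mul])⟩
    · exact ⟨g * a, b * h, .inr (.inl (by simp only [map_mul, mul_assoc]))⟩
    · exact ⟨g * a, b * h, .inr (.inr (by simp only [map_mul, mul_assoc]))⟩
  | zero => simp
  | add x y _ _ hx hy => rw [mul_add, add_mul]; exact add_mem hx hy
  | smul c x _ hx => rw [mul_smul_comm, smul_mul_assoc]; exact Submodule.smul_mem _ _ hx

theorem e_mem : e 0 ∈ Submodule.span ZDelta cellMonomials :=
  Submodule.subset_span ⟨1, 1, .inr (.inl (by simp))⟩

theorem f_mem : f ∈ Submodule.span ZDelta cellMonomials :=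
  Submodule.subset_span ⟨1, 1, .inr (.inr (by simp))⟩

/-- The element `r 1 * r 0 * r 1 * r 0` conjugates `e 1` to `e 0` and `r 2` to `d`, so this is a
conjugate of the relation `e 1 * r 2 * e 1 = e 1`. -/
theorem e_d_e : e 0 * ω H3.d * e 0 = e 0 := by
  have h1 : e 0 = r 1 * r 0 * r 1 * r 0 * e 1 * (r 0 * r 1 * r 0 * r 1) := by
    rw [mul_assoc, e_one_mul]
    simp only [mul_assoc, r_r_mul]
  have hd : ω H3.d = r 1 * r 0 * r 1 * r 0 * r 2 * (r 0 * r 1 * r 0 * r 1) := by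
    have h := r_comm (show coxeterH3 0 2 = 2 from rfl)
    have h' : r 0 * (r 2 * r 0) = r 2 := by rw [← mul_assoc, h, mul_assoc, r_sq, mul_one]
    have h'' : r 0 * r 2 * r 0 = r 2 := by rw [mul_assoc, h']
    calc ω H3.d = r 1 * r 0 * r 1 * (r 0 * r 2 * r 0) * (r 1 * r 0 * r 1) := by
          rw [h'']; simp only [H3.d, map_mul, ω_s, mul_assoc]
      _ = _ := by simp only [mul_assoc]
  have h2 : e 1 * (r 2 * e 1) = e 1 := by
    rw [← mul_assoc]; exact e_r_e_of_bond rfl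
  have h3 (x : BrH3) : e 1 * (r 2 * (e 1 * x)) = e 1 * x := by
    rw [← mul_assoc (r 2), ← mul_assoc (e 1), h2]
  rw [hd]
  simp only [h1, mul_assoc, r_r_mul, h3]

/-- Since `e 0` absorbs `s 0` and commutes with `s 2`, only six representatives matter: 1 gives a
scalar, `p` and `p⁻¹` give `f`, and `s 1`, `s 1 * s 0 * s 1`, `d` give back `e 0`. -/
theorem e_ω_u_e_mem (j : Fin 15) :
    e 0 * ω (H3.u j) * e 0 ∈ Submodule.span ZDelta cellMonomials := by
  have zero {x : H3.W} (h : e 0 * ω x * e 0 ∈ Submodule.span ZDelta cellMonomials) :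
      e 0 * ω (H3.s 0 * x) * e 0 ∈ Submodule.span ZDelta cellMonomials := by
    rwa [map_mul, ω_s, ← mul_assoc, e_r]
  have two {x : H3.W} (h : e 0 * ω x * e 0 ∈ Submodule.span ZDelta cellMonomials) :
      e 0 * ω (H3.s 2 * x) * e 0 ∈ Submodule.span ZDelta cellMonomials := by
    rw [map_mul, ω_s, ← mul_assoc, commute_e_r_two.eq, mul_assoc, mul_assoc]
    simpa [mul_assoc] using ω_mul_mem h (H3.s 2) 1
  have h3 : e 0 * ω (H3.s 1) * e 0 ∈ Submodule.span ZDelta cellMonomials := by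
    rw [ω_s, e_r_e_zero]; exact e_mem
  have h7 : e 0 * ω (H3.s 1 * (H3.s 0 * H3.s 1)) * e 0 ∈ Submodule.span ZDelta cellMonomials := by
    have h := e_rrr_e_zero
    simp only [mul_assoc] at h
    simp only [map_mul, ω_s, mul_assoc]
    rw [h]; exact e_mem
  have h11 : e 0 * ω H3.d * e 0 ∈ Submodule.span ZDelta cellMonomials := by
    rw [e_d_e]; exact e_mem
  fin_cases j
  · change e 0 * ω 1 * e 0 ∈ _
    rw [map_one, mul_one, e_sq]
    exact Submodule.smul_mem _ _ e_mem
  · change e 0 * ω H3.p * e 0 ∈ _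
    rw [mul_assoc, ω_p_mul_e, ← mul_assoc, ← f]
    simpa using ω_mul_mem f_mem 1 H3.p
  · change e 0 * ω H3.p⁻¹ * e 0 ∈ _
    rw [← ω_p_inv_mul_e, mul_assoc, ← f_eq]
    simpa using ω_mul_mem f_mem H3.p⁻¹ 1
  exacts [h3, zero h3, two h3, zero (two h3), h7, zero h7, two h7, zero (two h7),
    h11, zero h11, two h11, zero (two h11)]

theorem e_ω_e_mem (g : H3.W) : e 0 * ω g * e 0 ∈ Submodule.span ZDelta cellMonomials := by
  obtain ⟨j, k, l, rfl⟩ := H3.exists_eq_u_mul g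
  have h := ω_mul_mem (e_ω_u_e_mem j) 1 (H3.n l)
  rw [map_one, one_mul, mul_assoc, (commute_e_n l).eq] at h
  rw [H3.n_comm_zero l |>.symm.pow_left k |>.eq]
  simpa only [map_mul, mul_assoc, s_pow_mul_e] using h

theorem e_v_f (m : Fin 5) : ∃ c : ZDelta, e 0 * (ω (H3.v m) * f) = c • f := by
  have h1 := e_r_f
  have h2 := e_rrr_f
  have h3 (x : BrH3) : e 0 * (r 0 * x) = e 0 * x := by rw [← mul_assoc, e_r]
  have h4 (x : BrH3) : e 0 * (r 2 * x) = r 2 * (e 0 * x) := by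
    rw [← mul_assoc, commute_e_r_two.eq, mul_assoc]
  simp only [mul_assoc] at h1 h2
  refine ⟨(![brauerDelta ^ 2, 1, 1, 1, 1] : Fin 5 → ZDelta) m, ?_⟩
  fin_cases m <;> simp [H3.v, e_zero_mul_f, h1, h2, h3, h4, r_two_mul_f, mul_assoc]

theorem e_mul_mem {x : BrH3} (hx : x ∈ Submodule.span ZDelta cellMonomials) :
    e 0 * x ∈ Submodule.span ZDelta cellMonomials := by
  induction hx using Submodule.span_induction with
  | mem x hx =>
    obtain ⟨a, b, rfl | rfl | rfl⟩ := hx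
    · exact Submodule.subset_span ⟨1, a, .inr (.inl (by simp))⟩
    · simpa only [map_one, one_mul, mul_assoc] using ω_mul_mem (e_ω_e_mem a) 1 b
    · obtain ⟨m, hm⟩ := exists_ω_mul_f a
      obtain ⟨c, hc⟩ := e_v_f m
      rw [← mul_assoc, hm, hc]
      simpa using ω_mul_mem (Submodule.smul_mem _ c f_mem) 1 b
  | zero => simp
  | add x y _ _ hx hy => rw [mul_add]; exact add_mem hx hy
  | smul c x _ hx => rw [mul_smul_comm]; exact Submodule.smul_mem _ _ hx

theorem exists_e_eq (i : Fin 3) : ∃ g, e i = ω g * e 0 * ω g⁻¹ := by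
  have key (i : Fin 3) (g : H3.W) (h : e i * ω g = ω g * e 0) : ∃ g, e i = ω g * e 0 * ω g⁻¹ :=
    ⟨g, by rw [← h, mul_assoc, ω_mul_inv, mul_one]⟩
  fin_cases i
  · exact key 0 1 (by simp)
  · refine key 1 (H3.s 0 * H3.s 1 * H3.s 0 * H3.s 1) ?_
    simpa only [map_mul, ω_s] using e_one_mul
  · exact key 2 H3.p ω_p_mul_e.symm

theorem algHom_ext {A : Type*} [Semiring A] [Algebra ZDelta A] {φ ψ : BrH3 →ₐ[ZDelta] A}
    (hr : ∀ i, φ (r i) = ψ (r i)) (he : ∀ i, φ (e i) = ψ (e i)) : φ = ψ := by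
  apply RingQuot.ringQuot_ext'
  apply FreeAlgebra.hom_ext
  ext x
  cases x with
  | r i => exact hr i
  | e i => exact he i

theorem mul_mem_of_gen {L : Submodule ZDelta BrH3} (hr : ∀ i, ∀ x ∈ L, r i * x ∈ L)
    (he : ∀ i, ∀ x ∈ L, e i * x ∈ L) (y : BrH3) : ∀ x ∈ L, y * x ∈ L := by
  obtain ⟨a, rfl⟩ := RingQuot.mkAlgHom_surjective ZDelta BrH3Rel y
  induction a using FreeAlgebra.induction with
  | grade0 c =>
    intro x hx
    rw [AlgHom.commutes, ← Algebra.smul_def]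
    exact L.smul_mem _ hx
  | grade1 g =>
    cases g with
    | r i => exact hr i
    | e i => exact he i
  | mul a b ha hb =>
    intro x hx
    rw [map_mul, mul_assoc]
    exact ha _ (hb _ hx)
  | add a b ha hb =>
    intro x hx
    rw [map_add, add_mul]
    exact add_mem (ha _ hx) (hb _ hx)

/-- The span contains 1 and is a left ideal: stability under group elements and `e 0` suffices,
every `e i` being conjugate to `e 0`. -/
theorem span_cellMonomials : Submodule.span ZDelta cellMonomials = ⊤ := by
  rw [eq_top_iff]
  intro y _
  rw [← mul_one y]
  refine mul_mem_of_gen (fun i x hx => ?_) (fun i x hx => ?_) y 1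
    (Submodule.subset_span ⟨1, 1, .inl (by simp)⟩)
  · simpa using ω_mul_mem hx (H3.s i) 1
  · obtain ⟨g, hg⟩ := exists_e_eq i
    have h := ω_mul_mem (e_mul_mem (ω_mul_mem hx g⁻¹ 1)) g 1
    simpa only [hg, map_one, mul_one, mul_assoc] using h

/-- The index type of the basis. -/
abbrev Index : Type :=
  ((Fin 15 × Fin 2 × Fin 4) ⊕ (Fin 15 × Fin 4 × Fin 15)) ⊕ (Fin 5 × Fin 5)

/-- A basis of the Brauer algebra of type `H₃` that consists of monomials. -/
noncomputable def monomial : Index → BrH3 :=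
  Sum.elim
    (Sum.elim (fun x => ω (H3.u x.1 * (H3.s 0 ^ (x.2.1 : ℕ) * H3.n x.2.2)))
      (fun x => ω (H3.u x.1) * e 0 * ω (H3.n x.2.1) * ω (H3.u x.2.2)⁻¹))
    (fun x => ω (H3.v x.1) * f * ω (H3.v x.2)⁻¹)

theorem n_inv (l : Fin 4) : (H3.n l)⁻¹ = H3.n l := by
  apply inv_eq_of_mul_eq_one_left
  have h : H3.s 2 * H3.t * (H3.s 2 * H3.t) = 1 := by
    rw [mul_assoc, ← mul_assoc H3.t, H3.t_comm_two, mul_assoc, H3.t_sq, mul_one, H3.s_sq]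
  fin_cases l
  exacts [one_mul 1, H3.s_sq 2, H3.t_sq, h]

theorem span_monomial : Submodule.span ZDelta (Set.range monomial) = ⊤ := by
  rw [← span_cellMonomials]
  apply Submodule.span_eq_span
  · rintro _ ⟨(⟨j, k, l⟩ | ⟨j, l, j'⟩) | ⟨m, m'⟩, rfl⟩
    · exact Submodule.subset_span ⟨_, 1, .inl rfl⟩
    · exact Submodule.subset_span ⟨H3.u j, H3.n l * (H3.u j')⁻¹, .inr (.inl (by
        simp only [monomial, Sum.elim_inl, Sum.elim_inr, map_mul, mul_assoc]))⟩
    · exact Submodule.subset_span ⟨_, _, .inr (.inr rfl)⟩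
  · rintro x ⟨g, h, rfl | rfl | rfl⟩
    · obtain ⟨j, k, l, rfl⟩ := H3.exists_eq_u_mul g
      obtain ⟨k', hk⟩ := H3.exists_s_zero_pow k
      rw [hk]
      exact Submodule.subset_span ⟨.inl (.inl (j, k', l)), rfl⟩
    · obtain ⟨j, k, l, rfl⟩ := H3.exists_eq_u_mul g
      -- Factoring `h⁻¹` puts `u j'` at the outer right end. Powers of `s 0` vanish into `e 0`, and
      -- the two elements `n l`, `n l'` meet after passing `e 0`.
      obtain ⟨j', k', l', hh⟩ := H3.exists_eq_u_mul h⁻¹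
      obtain ⟨q, hq⟩ := H3.n_mul_n l l'
      have hh' : h = H3.s 0 ^ k' * H3.n l' * (H3.u j')⁻¹ := by
        rw [← inv_inv h, hh]
        simp only [mul_inv_rev, n_inv, ← inv_pow, H3.s_inv]
        rw [(H3.n_comm_zero l').symm.pow_left k' |>.eq]
      have hn := (commute_e_n l).eq
      refine Submodule.subset_span ⟨.inl (.inr (j, q, j')), ?_⟩
      simp only [monomial, Sum.elim_inl, Sum.elim_inr]
      rw [hh', ← hq, ← (H3.n_comm_zero l |>.pow_right k).eq]
      calc ω (H3.u j) * e 0 * ω (H3.n l * H3.n l') * ω (H3.u j')⁻¹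
          = ω (H3.u j) * (e 0 * ω (H3.n l)) * ω (H3.n l') * ω (H3.u j')⁻¹ := by
            simp only [map_mul, mul_assoc]
        _ = ω (H3.u j) * ω (H3.n l) * (ω (H3.s 0 ^ k) * e 0 * ω (H3.s 0 ^ k')) *
              ω (H3.n l') * ω (H3.u j')⁻¹ := by
            rw [hn, s_pow_mul_e, e_mul_s_pow]; simp only [mul_assoc]
        _ = _ := by simp only [map_mul, mul_assoc]
    · obtain ⟨m, hm⟩ := exists_ω_mul_f g
      obtain ⟨m', hm'⟩ := exists_f_mul_ω h
      refine Submodule.subset_span ⟨.inr (m, m'), ?_⟩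
      simp only [monomial, Sum.elim_inr]
      rw [← hm, mul_assoc, ← hm', mul_assoc]

end BrH3

/-! ### Signed matchings, reflections and Temperley-Lieb operators -/

/-- An involution that is either trivial or free. -/
structure Signing (P : Type) where
  σ : Equiv.Perm P
  σ_σ : ∀ x, σ (σ x) = x
  trivial_or_free : (∀ x, σ x = x) ∨ ∀ x, σ x ≠ x

namespace Signing

/-- Two points that differ up to sign. -/
def Sep {P : Type} (S : Signing P) (x y : P) : Prop := x ≠ y ∧ x ≠ S.σ y

/-- The group of signed permutations. -/
def Perms {P : Type} (S : Signing P) : Subgroup (Equiv.Perm P) := Subgroup.centralizer {S.σ}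

/-- The type of perfect matchings of `P` modulo signs, with a sign attached to each pair. -/
@[ext]
structure Matching {P : Type} (S : Signing P) where
  toPerms : S.Perms
  mul_self : toPerms * toPerms = 1
  sep : ∀ x, S.Sep (toPerms.1 x) x

theorem mem_perms {P : Type} {S : Signing P} {w : Equiv.Perm P} :
    w ∈ S.Perms ↔ ∀ x, w (S.σ x) = S.σ (w x) := by
  rw [Perms, Subgroup.mem_centralizer_singleton_iff, Equiv.ext_iff]
  exact ⟨fun h x => (h x), fun h x => (h x)⟩

section

variable {P : Type} {S : Signing P}

theorem Sep.symm {x y : P} (h : S.Sep x y) : S.Sep y x :=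
  ⟨h.1.symm, fun h' => h.2 (by rw [h', S.σ_σ])⟩

theorem Perms.apply_σ (w : S.Perms) (x : P) : w.1 (S.σ x) = S.σ (w.1 x) := mem_perms.1 w.2 x

theorem Sep.map {x y : P} (h : S.Sep x y) (w : S.Perms) : S.Sep (w.1 x) (w.1 y) :=
  ⟨fun h' => h.1 (w.1.injective h'), fun h' => h.2 (w.1.injective (by rw [h', Perms.apply_σ w]))⟩

theorem Sep.left {x y : P} (h : S.Sep x y) : S.Sep (S.σ x) y :=
  ⟨fun h' => h.2 (by rw [← h', S.σ_σ]), fun h' => h.1 (S.σ.injective h')⟩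

theorem Sep.right {x y : P} (h : S.Sep x y) : S.Sep x (S.σ y) := h.symm.left.symm

theorem Matching.apply_apply (m : S.Matching) (x : P) : m.1.1 (m.1.1 x) = x :=
  congrArg (fun w : S.Perms => w.1 x) m.mul_self

instance : MulAction S.Perms S.Matching where
  smul w m := ⟨w * m.1 * w⁻¹, by
      rw [show w * m.1 * w⁻¹ * (w * m.1 * w⁻¹) = w * (m.1 * m.1) * w⁻¹ by group, m.mul_self]
      group, fun x => by
      have h := (m.sep (w⁻¹.1 x)).map w
      have hw : w.1 (w⁻¹.1 x) = x := w.1.apply_symm_apply x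
      rwa [hw] at h⟩
  one_smul m := Matching.ext (by change 1 * m.1 * 1⁻¹ = m.1; group)
  mul_smul v w m := Matching.ext (by
    change v * w * m.1 * (v * w)⁻¹ = v * (w * m.1 * w⁻¹) * v⁻¹; group)

theorem toPerms_smul (w : S.Perms) (m : S.Matching) : (w • m).1 = w * m.1 * w⁻¹ := rfl

theorem smul_apply (w : S.Perms) (m : S.Matching) (x : P) :
    (w • m).1.1 (w.1 x) = w.1 (m.1.1 x) := by
  change w.1 (m.1.1 (w.1.symm (w.1 x))) = _
  rw [Equiv.symm_apply_apply]

theorem smul_eq_of_commute {w : S.Perms} {m : S.Matching} (h : Commute w m.1) : w • m = m :=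
  Matching.ext (by rw [toPerms_smul, h.eq, mul_inv_cancel_right])

/-- Conjugate involutions that commute act equally on the conjugating matching. -/
theorem smul_eq_smul_of_conj {v w : S.Perms} {m : S.Matching} (h : m.1 * v = w * m.1)
    (hvw : Commute v w) (hv : v * v = 1) (hw : w * w = 1) : v • m = w • m := by
  apply Matching.ext
  rw [toPerms_smul, toPerms_smul, inv_eq_of_mul_eq_one_left hv, inv_eq_of_mul_eq_one_left hw]
  have h' : m.1 * w = v * m.1 := by
    have h2 := congrArg (fun x => m.1 * x * m.1) h
    simp only [← mul_assoc, m.mul_self, one_mul] at h2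
    rw [h2, mul_assoc _ m.1 m.1, m.mul_self, mul_one]
  rw [← h', ← h, mul_assoc, mul_assoc, hvw.eq]

theorem apply_eq_comm {x y : P} (m : S.Matching) : m.1.1 x = y ↔ m.1.1 y = x :=
  ⟨fun h => by rw [← h, m.apply_apply], fun h => by rw [← h, m.apply_apply]⟩

theorem apply_eq_σ_comm {x y : P} (m : S.Matching) : m.1.1 x = S.σ y ↔ m.1.1 y = S.σ x := by
  rw [apply_eq_comm, Perms.apply_σ m.1]
  exact ⟨fun h => by rw [← h, S.σ_σ], fun h => by rw [h, S.σ_σ]⟩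

theorem sep_apply_comm {x y : P} (m : S.Matching) :
    S.Sep (m.1.1 x) y ↔ S.Sep (m.1.1 y) x := by
  rw [Sep, Sep, ne_eq, ne_eq, apply_eq_comm, apply_eq_σ_comm]

/-- The free module on the matchings. -/
abbrev Mod (S : Signing P) : Type := S.Matching →₀ ZDelta

/-- The action of a signed permutation. -/
noncomputable def opR (w : S.Perms) : Module.End ZDelta S.Mod :=
  Finsupp.lmapDomain ZDelta ZDelta (w • ·)

theorem opR_single (w : S.Perms) (m : S.Matching) (c : ZDelta) :
    opR w (Finsupp.single m c) = Finsupp.single (w • m) c :=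
  Finsupp.mapDomain_single

theorem end_ext {f g : Module.End ZDelta S.Mod}
    (h : ∀ m, f (Finsupp.single m 1) = g (Finsupp.single m 1)) : f = g :=
  Finsupp.lhom_ext' fun m => LinearMap.ext_ring (h m)

theorem opR_mul (v w : S.Perms) : opR v * opR w = opR (v * w) :=
  end_ext fun m => by simp only [Module.End.mul_apply, opR_single, mul_smul]

theorem opR_one : opR (1 : S.Perms) = 1 :=
  end_ext fun m => by simp only [Module.End.one_apply, opR_single, one_smul]

variable [DecidableEq P]

/-- The underlying function of a reflection. -/
def reflFun (S : Signing P) (x y z : P) : P :=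
  if z = x then y else if z = y then x else
    if z = S.σ x then S.σ y else if z = S.σ y then S.σ x else z

/-- This is where `trivial_or_free` is essential: if `σ` fixed `x` but not `y`, both `y` and `σ y`
would go to `x`. -/
theorem reflFun_reflFun (S : Signing P) (x y z : P) : S.reflFun x y (S.reflFun x y z) = z := by
  have h := S.σ_σ
  have hi := S.σ.injective
  rcases S.trivial_or_free with hf | hf
  · simp only [reflFun, hf]
    split_ifs <;> grind
  · have hx := hf x
    have hy := hf y
    have hxy : S.σ x = S.σ y → x = y := fun h => hi h
    have h1 := h x
    have h2 := h y
    clear hi h hf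
    simp only [reflFun]
    split_ifs <;> grind

theorem reflFun_σ (S : Signing P) (x y z : P) :
    S.reflFun x y (S.σ z) = S.σ (S.reflFun x y z) := by
  have h := S.σ_σ
  rcases S.trivial_or_free with hf | hf
  · simp only [hf]
  · have hx := hf x
    have hy := hf y
    have h1 := h x
    have h2 := h y
    have h3 := h z
    clear h hf
    simp only [reflFun]
    split_ifs <;> grind

/-- The reflection that interchanges `x` and `y`. -/
def refl (S : Signing P) (x y : P) : S.Perms :=
  ⟨⟨S.reflFun x y, S.reflFun x y, S.reflFun_reflFun x y, S.reflFun_reflFun x y⟩,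
    mem_perms.2 (S.reflFun_σ x y)⟩

theorem refl_apply (x y z : P) : (S.refl x y).1 z = S.reflFun x y z := rfl

theorem refl_mul_self (x y : P) : S.refl x y * S.refl x y = 1 :=
  Subtype.ext (Equiv.ext (S.reflFun_reflFun x y))

theorem refl_apply_left (x y : P) : (S.refl x y).1 x = y := by
  simp [refl_apply, reflFun]

theorem refl_apply_right (x y : P) : (S.refl x y).1 y = x := by
  by_cases h : y = x <;> simp [refl_apply, reflFun, h]

theorem refl_apply_of_sep {x y z : P} (hx : S.Sep z x) (hy : S.Sep z y) :
    (S.refl x y).1 z = z := by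
  simp [refl_apply, reflFun, hx.1, hx.2, hy.1, hy.2]

theorem refl_self (x : P) : S.refl x x = 1 := by
  ext z
  change S.reflFun x x z = z
  simp only [reflFun]
  split_ifs <;> simp_all

/-- Conjugation relabels points. Symmetry, sign invariance, commutation and the braid relation for
reflections are all derived from this. -/
theorem mul_refl (w : S.Perms) (x y : P) : w * S.refl x y = S.refl (w.1 x) (w.1 y) * w := by
  ext z
  change w.1 (S.reflFun x y z) = S.reflFun (w.1 x) (w.1 y) (w.1 z)
  simp only [reflFun, ← Perms.apply_σ w, w.1.injective.eq_iff]
  split_ifs <;> rfl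

theorem refl_symm (x y : P) : S.refl x y = S.refl y x := by
  have h := mul_refl (S.refl x y) x y
  rw [refl_apply_left, refl_apply_right] at h
  exact mul_right_cancel h

theorem refl_σ (x y : P) : S.refl (S.σ x) (S.σ y) = S.refl x y := by
  let s : S.Perms := ⟨S.σ, mem_perms.2 fun _ => rfl⟩
  have h := mul_refl s x y
  have h' : s * S.refl x y = S.refl x y * s := by
    ext z
    exact (Perms.apply_σ (S.refl x y) z).symm
  exact mul_right_cancel (h.symm.trans h')

theorem refl_commute {x y z w : P} (hxz : S.Sep x z) (hxw : S.Sep x w) (hyz : S.Sep y z)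
    (hyw : S.Sep y w) : Commute (S.refl x y) (S.refl z w) := by
  have h := mul_refl (S.refl x y) z w
  rwa [refl_apply_of_sep hxz.symm hyz.symm, refl_apply_of_sep hxw.symm hyw.symm] at h

theorem refl_smul_of_apply_eq {m : S.Matching} {x y : P} (h : m.1.1 x = y) :
    S.refl x y • m = m := by
  apply smul_eq_of_commute
  have h' := mul_refl m.1 x y
  rw [h, ← h, m.apply_apply, h, refl_symm y x] at h'
  exact h'.symm

/-- The effect of a Temperley-Lieb generator on a matching, up to a scalar: `x` and `y` are
matched, as are their former partners. -/
def join (x y : P) (m : S.Matching) : S.Matching := S.refl y (m.1.1 x) • m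

theorem join_apply {x y : P} (h : S.Sep x y) (m : S.Matching) : (join x y m).1.1 x = y := by
  have hx := refl_apply_of_sep h (m.sep x).symm
  have h' := smul_apply (S.refl y (m.1.1 x)) m x
  rwa [hx, refl_apply_right] at h'

theorem join_of_apply_eq {x y : P} {m : S.Matching} (h : m.1.1 x = y) : join x y m = m := by
  rw [join, h, refl_self, one_smul]

/-- `m` conjugates the reflection of `y` and the partner of `x` into that of `x` and the partner of
`y`; as these commute, they move `m` to the same matching. -/
theorem join_symm {x y : P} (m : S.Matching) (h : S.Sep x y) :
    join x y m = join y x m := by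
  refine smul_eq_smul_of_conj ?_ ?_ (refl_mul_self _ _) (refl_mul_self _ _)
  · rw [mul_refl, m.apply_apply, refl_symm]
  · exact refl_commute h.symm (m.sep y).symm (m.sep x) (h.map m.1)

theorem smul_join (w : S.Perms) (x y : P) (m : S.Matching) :
    w • join x y m = join (w.1 x) (w.1 y) (w • m) := by
  rw [join, join, smul_apply, smul_smul, smul_smul, mul_refl]

theorem join_apply_of_sep {x y z : P} {m : S.Matching} (hx : S.Sep z x) (hy : S.Sep z y)
    (hm : S.Sep (m.1.1 z) x) (hm' : S.Sep (m.1.1 z) y) : (join x y m).1.1 z = m.1.1 z := by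
  have h := smul_apply (S.refl y (m.1.1 x)) m z
  rwa [refl_apply_of_sep hy ((sep_apply_comm m).1 hm).symm,
    refl_apply_of_sep hm' (hx.map m.1)] at h

/-- The scalar by which a Temperley-Lieb generator acts on a matching: a closed loop with sign
gives zero. -/
noncomputable def coef (x y : P) (m : S.Matching) : ZDelta :=
  if m.1.1 x = y then brauerDelta else if m.1.1 x = S.σ y then 0 else 1

theorem coef_of_eq {x y : P} {m : S.Matching} (h : m.1.1 x = y) : coef x y m = brauerDelta :=
  if_pos h

theorem coef_of_eq_σ {x y : P} {m : S.Matching} (h : m.1.1 x = S.σ y) (h' : S.σ y ≠ y) :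
    coef x y m = 0 := by
  rw [coef, if_neg (h ▸ h'), if_pos h]

theorem coef_of_sep {x y : P} {m : S.Matching} (h : S.Sep (m.1.1 x) y) : coef x y m = 1 := by
  rw [coef, if_neg h.1, if_neg h.2]

theorem coef_symm (x y : P) (m : S.Matching) : coef x y m = coef y x m := by
  simp only [coef, apply_eq_comm m (x := x) (y := y), apply_eq_σ_comm m (x := x) (y := y)]

theorem coef_congr {x y : P} {m m' : S.Matching} (h : m.1.1 x = m'.1.1 x) :
    coef x y m = coef x y m' := by
  rw [coef, coef, h]

theorem coef_smul (w : S.Perms) (x y : P) (m : S.Matching) :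
    coef (w.1 x) (w.1 y) (w • m) = coef x y m := by
  simp only [coef, smul_apply, ← Perms.apply_σ w, w.1.injective.eq_iff]

/-- The action of the Temperley-Lieb element that belongs to the points `x` and `y`. -/
noncomputable def opE (S : Signing P) (x y : P) : Module.End ZDelta S.Mod :=
  Finsupp.linearCombination ZDelta fun m => Finsupp.single (join x y m) (coef x y m)

theorem opE_single (x y : P) (m : S.Matching) (c : ZDelta) :
    S.opE x y (Finsupp.single m c) = Finsupp.single (join x y m) (c * coef x y m) := by
  rw [opE, Finsupp.linearCombination_single, Finsupp.smul_single, smul_eq_mul]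

theorem opR_mul_opE (w : S.Perms) (x y : P) :
    opR w * S.opE x y = S.opE (w.1 x) (w.1 y) * opR w :=
  end_ext fun m => by
    simp only [Module.End.mul_apply, opR_single, opE_single, smul_join, coef_smul]

theorem opE_mul_self {x y : P} (h : S.Sep x y) :
    S.opE x y * S.opE x y = brauerDelta • S.opE x y :=
  end_ext fun m => by
    have h' := join_apply h m
    simp only [Module.End.mul_apply, opE_single, join_of_apply_eq h', coef_of_eq h',
      LinearMap.smul_apply, Finsupp.smul_single, smul_eq_mul, mul_comm]

theorem opR_refl_mul_opE {x y : P} (h : S.Sep x y) :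
    opR (S.refl x y) * S.opE x y = S.opE x y :=
  end_ext fun m => by
    simp only [Module.End.mul_apply, opR_single, opE_single,
      refl_smul_of_apply_eq (join_apply h m)]

theorem opE_symm {x y : P} (h : S.Sep x y) : S.opE x y = S.opE y x :=
  end_ext fun m => by
    simp only [opE_single, coef_symm y x]
    by_cases hm : S.Sep (m.1.1 x) y
    · rw [join_symm m h]
    by_cases h1 : m.1.1 x = y
    · rw [join_of_apply_eq h1, join_of_apply_eq ((apply_eq_comm m).1 h1)]
    · have h2 : m.1.1 x = S.σ y := by by_contra h2; exact hm ⟨h1, h2⟩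
      rw [coef_of_eq_σ h2 (fun h3 => h1 (h2.trans h3)), mul_zero, Finsupp.single_zero,
        Finsupp.single_zero]

theorem opE_σ (x y : P) : S.opE (S.σ x) (S.σ y) = S.opE x y :=
  end_ext fun m => by
    have h : coef (S.σ x) (S.σ y) m = coef x y m := by
      simp only [coef, Perms.apply_σ m.1, S.σ.injective.eq_iff]
    rw [opE_single, opE_single, h, join, join, Perms.apply_σ m.1, refl_σ]

theorem opE_mul_opR_refl {x y : P} (h : S.Sep x y) :
    S.opE x y * opR (S.refl x y) = S.opE x y := by
  have h' := opR_mul_opE (S.refl x y) y x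
  rw [refl_apply_left, refl_apply_right, ← opE_symm h] at h'
  rw [← h', opR_refl_mul_opE h]

/-- The relation `r_j r_i e_j = e_i e_j`. -/
theorem opR_mul_opR_mul_opE {x y w : P} (hxy : S.Sep x y) (hyw : S.Sep y w) (hxw : S.Sep x w) :
    opR (S.refl y w) * opR (S.refl x y) * S.opE y w = S.opE x y * S.opE y w :=
  end_ext fun m => by
    have h := join_apply hyw m
    -- With `y` and `w` matched, `refl y w` acts trivially. What remains exchanges `x` with the
    -- partner `w` of `y`, which is the effect of joining `y` to `x`.
    have hR : (S.refl y w * S.refl x y) • join y w m = S.refl x w • join y w m := by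
      have h1 := mul_refl (S.refl y w) x y
      rw [refl_apply_of_sep hxy hxw, refl_apply_left] at h1
      rw [h1, mul_smul, refl_smul_of_apply_eq h]
    have hc : coef y x (join y w m) = 1 := coef_of_sep (by rw [h]; exact hxw.symm)
    rw [opE_symm hxy]
    simp only [Module.End.mul_apply, opE_single, opR_single, ← mul_smul, hR, hc, mul_one]
    rw [join.eq_1 y x, h]

/-- The relation `r_i e_j r_i = r_j e_i r_j`. -/
theorem opR_mul_opE_mul_opR {x y w : P} (hxy : S.Sep x y) (hyw : S.Sep y w) (hxw : S.Sep x w) :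
    opR (S.refl x y) * S.opE y w * opR (S.refl x y) =
      opR (S.refl y w) * S.opE x y * opR (S.refl y w) := by
  rw [opR_mul_opE, opR_mul_opE, refl_apply_right, refl_apply_of_sep hxw.symm hyw.symm,
    refl_apply_left, refl_apply_of_sep hxy hxw, mul_assoc, mul_assoc, opR_mul, opR_mul,
    refl_mul_self, refl_mul_self]

/-- At most one edge, between `y` and `w`, links the two pairs. Each join then leaves the partner
used by the other unchanged, and the two reflections commute. -/
theorem opE_comm_of_sep {x y z w : P} {m : S.Matching} (hxz : S.Sep x z) (hxw : S.Sep x w)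
    (hyz : S.Sep y z) (hyw : S.Sep y w) (h1 : S.Sep (m.1.1 x) z) (h2 : S.Sep (m.1.1 x) w)
    (h3 : S.Sep (m.1.1 z) y) :
    (S.opE x y * S.opE z w) (Finsupp.single m 1) =
      (S.opE z w * S.opE x y) (Finsupp.single m 1) := by
  have h1' := (sep_apply_comm m).1 h1
  have hx := join_apply_of_sep hxz hxw h1 h2
  have hz := join_apply_of_sep hxz.symm hyz.symm h1' h3
  simp only [Module.End.mul_apply, opE_single, one_mul, coef_congr hx, coef_congr hz]
  rw [mul_comm, join, hx, join, join, hz, join, smul_smul, smul_smul]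
  have hc : Commute (S.refl y (m.1.1 x)) (S.refl w (m.1.1 z)) :=
    refl_commute hyw h3.symm h2 (hxz.map m.1)
  rw [hc.eq]

/-- The edges `x`–`z` and `y`–`w` form a circuit with the two joins: whichever join comes first
creates both new edges, and the second closes a loop worth `δ`. -/
theorem opE_comm_of_apply_eq {x y z w : P} {m : S.Matching} (hxy : S.Sep x y) (hxz : S.Sep x z)
    (hxw : S.Sep x w) (hyz : S.Sep y z) (hyw : S.Sep y w) (hzw : S.Sep z w) (h1 : m.1.1 x = z)
    (h2 : m.1.1 y = w) :
    (S.opE x y * S.opE z w) (Finsupp.single m 1) =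
      (S.opE z w * S.opE x y) (Finsupp.single m 1) := by
  have h1' := (apply_eq_comm m).1 h1
  have h2' := (apply_eq_comm m).1 h2
  have e1 : (join z w m).1.1 x = y := by
    have h := smul_apply (S.refl w x) m w
    rw [join, h1']
    rwa [refl_apply_left, h2', refl_apply_of_sep hyw hxy.symm] at h
  have e2 : (join x y m).1.1 z = w := by
    have h := smul_apply (S.refl y z) m y
    rw [join, h1]
    rwa [refl_apply_left, h2, refl_apply_of_sep hyw.symm hzw.symm] at h
  have hs : join z w m = join x y m := by
    rw [join, join, h1, h1']
    refine smul_eq_smul_of_conj ?_ ?_ (refl_mul_self _ _) (refl_mul_self _ _)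
    · rw [mul_refl, h2', h1]
    · exact refl_commute hyw.symm hzw.symm hxy hxz
  simp only [Module.End.mul_apply, opE_single, one_mul]
  rw [join_of_apply_eq e1, join_of_apply_eq e2, hs, coef_of_eq e2,
    coef_of_sep (x := x) (m := m) (h1 ▸ hyz.symm), coef_of_sep (x := z) (h1' ▸ hxw), ← hs,
    coef_of_eq e1]

/-- The same circuit with a nontrivial total sign: both products are zero. -/
theorem opE_comm_of_apply_eq_σ {x y z w : P} {m : S.Matching} (hxy : S.Sep x y)
    (hyw : S.Sep y w) (hzw : S.Sep z w) (hf : ∀ p, S.σ p ≠ p)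
    (h1 : m.1.1 x = z) (h2 : m.1.1 y = S.σ w) :
    (S.opE x y * S.opE z w) (Finsupp.single m 1) =
      (S.opE z w * S.opE x y) (Finsupp.single m 1) := by
  have h1' := (apply_eq_comm m).1 h1
  have h2' := (apply_eq_σ_comm m).1 h2
  have e1 : (join z w m).1.1 x = S.σ y := by
    have h := smul_apply (S.refl w x) m w
    rw [join, h1']
    rwa [refl_apply_left, h2', Perms.apply_σ, refl_apply_of_sep hyw hxy.symm] at h
  have e2 : (join x y m).1.1 z = S.σ w := by
    have h := smul_apply (S.refl y z) m y
    rw [join, h1]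
    rwa [refl_apply_left, h2, Perms.apply_σ, refl_apply_of_sep hyw.symm hzw.symm] at h
  simp only [Module.End.mul_apply, opE_single, one_mul]
  rw [coef_of_eq_σ e1 (hf y), coef_of_eq_σ e2 (hf w), mul_zero, mul_zero, Finsupp.single_zero,
    Finsupp.single_zero]

theorem opE_comm_of_not_sep {x y z w : P} {m : S.Matching} (hxy : S.Sep x y) (hxz : S.Sep x z)
    (hxw : S.Sep x w) (hyz : S.Sep y z) (hyw : S.Sep y w) (hzw : S.Sep z w)
    (h1 : ¬ S.Sep (m.1.1 x) z) (h2 : ¬ S.Sep (m.1.1 y) w) :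
    (S.opE x y * S.opE z w) (Finsupp.single m 1) =
      (S.opE z w * S.opE x y) (Finsupp.single m 1) := by
  -- Applying `σ` to `z` and `w` together does not change `opE z w`.
  wlog h3 : m.1.1 x = z generalizing z w
  · have h4 : m.1.1 x = S.σ z := by by_contra h4; exact h1 ⟨h3, h4⟩
    rw [← opE_σ z w]
    exact this hxz.right hxw.right hyz.right hyw.right hzw.left.right (fun h => h.1 h4)
      (fun h => h2 (by simpa only [S.σ_σ] using h.right)) h4
  by_cases h4 : m.1.1 y = w
  · exact opE_comm_of_apply_eq hxy hxz hxw hyz hyw hzw h3 h4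
  · have h5 : m.1.1 y = S.σ w := by by_contra h5; exact h2 ⟨h4, h5⟩
    refine opE_comm_of_apply_eq_σ hxy hyw hzw ?_ h3 h5
    exact S.trivial_or_free.resolve_left fun h => h4 (h5.trans (h w))

/-- Edges linking the two pairs number at most two. After interchanging `x` with `y` or `z` with
`w`, one of the preceding cases applies. -/
theorem opE_comm {x y z w : P} (hxy : S.Sep x y) (hxz : S.Sep x z)
    (hxw : S.Sep x w) (hyz : S.Sep y z) (hyw : S.Sep y w) (hzw : S.Sep z w) :
    S.opE x y * S.opE z w = S.opE z w * S.opE x y := by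
  refine end_ext fun m => ?_
  have distinct {a b c : P} (hbc : S.Sep b c) (h : ¬ S.Sep (m.1.1 a) b) : S.Sep (m.1.1 a) c := by
    by_contra h'
    have hb : m.1.1 a = b ∨ m.1.1 a = S.σ b := by
      by_contra hb; push Not at hb; exact h hb
    have hc : m.1.1 a = c ∨ m.1.1 a = S.σ c := by
      by_contra hc; push Not at hc; exact h' hc
    rcases hb with hb | hb <;> rcases hc with hc | hc
    · exact hbc.1 (hb.symm.trans hc)
    · exact hbc.2 (hb.symm.trans hc)
    · exact hbc.left.1 (hb.symm.trans hc)
    · exact hbc.left.2 (hb.symm.trans hc)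
  have distinct' {a b c : P} (hbc : S.Sep b c) (h : ¬ S.Sep (m.1.1 b) a) : S.Sep (m.1.1 c) a :=
    (sep_apply_comm m).1 (distinct hbc fun h' => h ((sep_apply_comm m).1 h'))
  by_cases h1 : S.Sep (m.1.1 x) z
  · by_cases h2 : S.Sep (m.1.1 x) w
    · by_cases h3 : S.Sep (m.1.1 y) z
      · exact opE_comm_of_sep hxz hxw hyz hyw h1 h2 ((sep_apply_comm m).1 h3)
      · rw [opE_symm hzw]
        exact opE_comm_of_sep hxw hxz hyw hyz h2 h1 ((sep_apply_comm m).1 (distinct hzw h3))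
    · by_cases h3 : S.Sep (m.1.1 y) z
      · rw [opE_symm hxy]
        exact opE_comm_of_sep hyz hyw hxz hxw h3 (distinct' hxy h2) ((sep_apply_comm m).1 h1)
      · rw [opE_symm hzw]
        exact opE_comm_of_not_sep hxy hxw hxz hyw hyz hzw.symm h2 h3
  · by_cases h2 : S.Sep (m.1.1 y) w
    · rw [opE_symm hxy, opE_symm hzw]
      exact opE_comm_of_sep hyw hyz hxw hxz h2 (distinct' hxy h1)
        ((sep_apply_comm m).1 (distinct hzw h1))
    · exact opE_comm_of_not_sep hxy hxz hxw hyz hyw hzw h1 h2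

theorem opE_mul_opE_σ {x y : P} (h : S.Sep x y) (hy : S.σ y ≠ y) :
    S.opE x y * S.opE x (S.σ y) = 0 :=
  end_ext fun m => by
    simp only [Module.End.mul_apply, opE_single, coef_of_eq_σ (join_apply h.right m) hy, mul_zero,
      Finsupp.single_zero, LinearMap.zero_apply]

/-- The case of the two end nodes of the fork in `D₆`: under a free signing both products vanish,
under a trivial one the two operators coincide. -/
theorem opE_comm_σ {x y : P} (h : S.Sep x y) :
    S.opE x y * S.opE x (S.σ y) = S.opE x (S.σ y) * S.opE x y := by
  by_cases hy : S.σ y = y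
  · rw [hy]
  · have h' := opE_mul_opE_σ h.right (by rw [S.σ_σ]; exact fun h' => hy h'.symm)
    rw [S.σ_σ] at h'
    rw [opE_mul_opE_σ h hy, h']

end

end Signing

/-! ### The representation of `Br(D₆)` on matchings -/

theorem graphD6_adj_iff (i j : Fin 6) : graphD6.Adj i j ↔
    (i, j) ∈ [((0 : Fin 6), (2 : Fin 6)), (1, 2), (2, 3), (3, 4), (4, 5)] ∨
      (j, i) ∈ [((0 : Fin 6), (2 : Fin 6)), (1, 2), (2, 3), (3, 4), (4, 5)] := by
  fin_cases i <;> fin_cases j <;> simp [graphD6]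

instance : DecidableRel graphD6.Adj := fun i j => decidable_of_iff' _ (graphD6_adj_iff i j)

namespace Signing

section

/-- The first points of the simple roots. -/
def rootFst {P : Type} (S : Signing P) (pt : Fin 6 → P) : Fin 6 → P :=
  ![S.σ (pt 0), pt 0, pt 1, pt 2, pt 3, pt 4]

/-- The second points of the simple roots. -/
def rootSnd {P : Type} (pt : Fin 6 → P) : Fin 6 → P := ![pt 1, pt 1, pt 2, pt 3, pt 4, pt 5]

theorem sep_simple {P : Type} {S : Signing P} {pt : Fin 6 → P}
    (hp : ∀ i j, i ≠ j → S.Sep (pt i) (pt j)) (i : Fin 6) : S.Sep (S.rootFst pt i) (rootSnd pt i) := by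
  fin_cases i
  exacts [(hp 0 1 (by decide)).left, hp 0 1 (by decide), hp 1 2 (by decide), hp 2 3 (by decide),
    hp 3 4 (by decide), hp 4 5 (by decide)]

variable {P : Type} [DecidableEq P] {S : Signing P} {pt : Fin 6 → P}

/-- The simple reflection that belongs to a node of the Dynkin diagram. -/
def simpleRefl (S : Signing P) (pt : Fin 6 → P) (i : Fin 6) : S.Perms :=
  S.refl (S.rootFst pt i) (rootSnd pt i)

/-- The image of a Temperley-Lieb generator. -/
noncomputable def simpleE (S : Signing P) (pt : Fin 6 → P) (i : Fin 6) : Module.End ZDelta S.Mod :=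
  S.opE (S.rootFst pt i) (rootSnd pt i)

variable (hp : ∀ i j, i ≠ j → S.Sep (pt i) (pt j))
include hp

theorem exists_of_adj {i j : Fin 6} (h : graphD6.Adj i j) : ∃ x y w, S.Sep x y ∧ S.Sep y w ∧
    S.Sep x w ∧ S.simpleRefl pt i = S.refl x y ∧ S.simpleE pt i = S.opE x y ∧
    S.simpleRefl pt j = S.refl y w ∧ S.simpleE pt j = S.opE y w := by
  have key {i j : Fin 6}
      (h : (i, j) ∈ [((0 : Fin 6), (2 : Fin 6)), (1, 2), (2, 3), (3, 4), (4, 5)]) :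
      rootSnd pt i = S.rootFst pt j ∧ S.Sep (S.rootFst pt i) (rootSnd pt j) := by
    simp only [List.mem_cons, Prod.mk.injEq, List.not_mem_nil, or_false] at h
    obtain ⟨rfl, rfl⟩ | ⟨rfl, rfl⟩ | ⟨rfl, rfl⟩ | ⟨rfl, rfl⟩ | ⟨rfl, rfl⟩ := h
    exacts [⟨rfl, (hp 0 2 (by decide)).left⟩, ⟨rfl, hp 0 2 (by decide)⟩,
      ⟨rfl, hp 1 3 (by decide)⟩, ⟨rfl, hp 2 4 (by decide)⟩, ⟨rfl, hp 3 5 (by decide)⟩]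
  rcases (graphD6_adj_iff i j).1 h with h | h
  · obtain ⟨h1, h2⟩ := key h
    have hj := sep_simple hp j
    rw [← h1] at hj
    exact ⟨_, rootSnd pt i, _, sep_simple hp i, hj, h2, rfl, rfl, by rw [h1]; rfl, by rw [h1]; rfl⟩
  · obtain ⟨h1, h2⟩ := key h
    have hi := sep_simple hp i
    have hj := sep_simple hp j
    rw [← h1] at hi
    refine ⟨rootSnd pt i, rootSnd pt j, S.rootFst pt j, hi.symm, hj.symm, h2.symm, ?_, ?_,
      refl_symm _ _, opE_symm hj⟩
    · rw [refl_symm, h1]; rfl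
    · rw [opE_symm hi.symm, h1]; rfl

theorem simple_comm {i j : Fin 6} (hij : i ≠ j) (h : ¬ graphD6.Adj i j) :
    S.simpleRefl pt i * S.simpleRefl pt j = S.simpleRefl pt j * S.simpleRefl pt i ∧
    S.simpleE pt i * opR (S.simpleRefl pt j) = opR (S.simpleRefl pt j) * S.simpleE pt i ∧
    S.simpleE pt i * S.simpleE pt j = S.simpleE pt j * S.simpleE pt i := by
  -- The positions of the two points of each root, signs ignored. Non-adjacent nodes have disjoint
  -- positions, except nodes 0 and 1, which share both and differ in sign.
  let a : Fin 6 → Fin 6 := ![0, 0, 1, 2, 3, 4]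
  let b : Fin 6 → Fin 6 := ![1, 1, 2, 3, 4, 5]
  have ha (i) : S.rootFst pt i = pt (a i) ∨ S.rootFst pt i = S.σ (pt (a i)) := by
    fin_cases i
    exacts [.inr rfl, .inl rfl, .inl rfl, .inl rfl, .inl rfl, .inl rfl]
  have hb (i) : rootSnd pt i = pt (b i) := by fin_cases i <;> rfl
  have hab (i k) (h : a i ≠ k) : S.Sep (S.rootFst pt i) (pt k) := by
    rcases ha i with h' | h' <;> rw [h']
    exacts [hp _ _ h, (hp _ _ h).left]
  have haa (i j) (h : a i ≠ a j) : S.Sep (S.rootFst pt i) (S.rootFst pt j) := by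
    rcases ha j with h' | h' <;> rw [h']
    exacts [hab _ _ h, (hab _ _ h).right]
  have hd : ∀ i j : Fin 6, i ≠ j → ¬ graphD6.Adj i j →
      (a i ≠ a j ∧ a i ≠ b j ∧ b i ≠ a j ∧ b i ≠ b j) ∨ (i = 0 ∧ j = 1) ∨ (i = 1 ∧ j = 0) := by
    decide
  have h01 := hp 0 1 (by decide)
  have e0 : S.simpleE pt 0 = S.opE (pt 1) (S.σ (pt 0)) := opE_symm h01.left
  have e1 : S.simpleE pt 1 = S.opE (pt 1) (pt 0) := opE_symm h01
  have r0 : S.simpleRefl pt 0 = S.refl (pt 1) (S.σ (pt 0)) := refl_symm _ _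
  have r1 : S.simpleRefl pt 1 = S.refl (pt 1) (pt 0) := refl_symm _ _
  have t0 : (S.simpleRefl pt 0).1 (pt 1) = S.σ (pt 0) := by rw [r0, refl_apply_left]
  have t0' : (S.simpleRefl pt 0).1 (pt 0) = S.σ (pt 1) := by
    rw [r0, ← S.σ_σ (pt 0), S.σ_σ, Perms.apply_σ, refl_apply_right]
  have t1 : (S.simpleRefl pt 1).1 (pt 1) = pt 0 := by rw [r1, refl_apply_left]
  have t1' : (S.simpleRefl pt 1).1 (S.σ (pt 0)) = S.σ (pt 1) := by
    rw [r1, Perms.apply_σ, refl_apply_right]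
  have c : S.simpleRefl pt 0 * S.simpleRefl pt 1 = S.simpleRefl pt 1 * S.simpleRefl pt 0 := by
    have h := mul_refl (S.simpleRefl pt 0) (pt 1) (pt 0)
    rwa [t0, t0', refl_σ, refl_symm (pt 0), ← r1] at h
  rcases hd i j hij h with ⟨h1, h2, h3, h4⟩ | ⟨rfl, rfl⟩ | ⟨rfl, rfl⟩
  · have s1 := haa _ _ h1
    have s2 := hab _ _ h2
    have s3 := (hab _ _ h3.symm).symm
    have s4 := hp _ _ h4
    rw [← hb] at s2 s3 s4
    rw [← hb] at s4
    have h5 : (S.simpleRefl pt j).1 (S.rootFst pt i) = S.rootFst pt i := refl_apply_of_sep s1 s2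
    have h6 : (S.simpleRefl pt j).1 (rootSnd pt i) = rootSnd pt i := refl_apply_of_sep s3 s4
    refine ⟨(refl_commute s1 s2 s3 s4).eq, ?_, ?_⟩
    · have h7 := opR_mul_opE (S.simpleRefl pt j) (S.rootFst pt i) (rootSnd pt i)
      rw [h5, h6] at h7
      exact h7.symm
    · exact opE_comm (sep_simple hp i) s1 s2 s3 s4 (sep_simple hp j)
  · refine ⟨c, ?_, ?_⟩
    · rw [e0, opR_mul_opE, t1, t1', opE_symm h01.right, ← opE_σ (S.σ (pt 1)), S.σ_σ]
    · rw [e0, e1, opE_comm_σ h01.symm]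
  · refine ⟨c.symm, ?_, ?_⟩
    · rw [e1, opR_mul_opE, t0, t0', opE_symm h01.left.right, opE_σ]
    · rw [e0, e1, opE_comm_σ h01.symm]

/-- The values of the generators of the Brauer algebra of type `D₆` on matchings. -/
noncomputable def genImage (S : Signing P) (pt : Fin 6 → P) :
    BrauerGen (Fin 6) → Module.End ZDelta S.Mod
  | .r i => opR (S.simpleRefl pt i)
  | .e i => S.simpleE pt i

theorem lift_genImage_rel ⦃x y : BrauerFree (Fin 6)⦄
    (h : BrauerRel graphD6.Adj (fun i j => i ≠ j ∧ ¬ graphD6.Adj i j) brauerDelta x y) :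
    FreeAlgebra.lift ZDelta (genImage S pt) x = FreeAlgebra.lift ZDelta (genImage S pt) y := by
  cases h with
  | r_sq i =>
    simp [freeR, genImage, opR_mul, simpleRefl, refl_mul_self, opR_one]
  | r_e i =>
    simpa [freeR, freeE, genImage, simpleRefl, simpleE] using opR_refl_mul_opE (sep_simple hp i)
  | e_r i =>
    simpa [freeR, freeE, genImage, simpleRefl, simpleE] using opE_mul_opR_refl (sep_simple hp i)
  | e_sq i =>
    simpa [freeE, genImage, simpleRefl, simpleE] using opE_mul_self (sep_simple hp i)
  | r_comm i j h =>
    simp [freeR, genImage, opR_mul, (simple_comm hp h.1 h.2).1]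
  | e_r_comm i j h =>
    simpa [freeR, freeE, genImage] using (simple_comm hp h.1 h.2).2.1
  | e_comm i j h =>
    simpa [freeR, freeE, genImage] using (simple_comm hp h.1 h.2).2.2
  | braid i j h =>
    obtain ⟨x, y, w, hxy, hyw, hxw, ri, -, rj, -⟩ := exists_of_adj hp h
    have h1 := mul_refl (S.refl x y) y w
    have h2 := mul_refl (S.refl y w) x y
    rw [refl_apply_right, refl_apply_of_sep hxw.symm hyw.symm] at h1
    rw [refl_apply_left, refl_apply_of_sep hxy hxw] at h2
    have h3 : S.refl x y * S.refl y w * S.refl x y = S.refl y w * S.refl x y * S.refl y w := by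
      rw [h1, h2, mul_assoc, mul_assoc, refl_mul_self, refl_mul_self]
    simp [freeR, genImage, opR_mul, ri, rj, h3]
  | r_r_e i j h =>
    obtain ⟨x, y, w, hxy, hyw, hxw, ri, ei, rj, ej⟩ := exists_of_adj hp h
    simpa [freeR, freeE, genImage, ri, ei, rj, ej] using opR_mul_opR_mul_opE hxy hyw hxw
  | r_e_r i j h =>
    obtain ⟨x, y, w, hxy, hyw, hxw, ri, ei, rj, ej⟩ := exists_of_adj hp h
    simpa [freeR, freeE, genImage, ri, ei, rj, ej] using opR_mul_opE_mul_opR hxy hyw hxw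

/-- The representation of the Brauer algebra of type `D₆` on matchings. -/
noncomputable def rep : BrD6 →ₐ[ZDelta] Module.End ZDelta S.Mod :=
  RingQuot.liftAlgHom ZDelta ⟨FreeAlgebra.lift ZDelta (genImage S pt), lift_genImage_rel hp⟩

theorem rep_R (i : Fin 6) : rep hp (BrD6.R i) = opR (S.simpleRefl pt i) := by
  simp [rep, BrD6.R, SimplyLacedBrauerAlgebra.R, freeR, genImage]

theorem rep_E (i : Fin 6) : rep hp (BrD6.E i) = S.simpleE pt i := by
  simp [rep, BrD6.E, SimplyLacedBrauerAlgebra.E, freeE, genImage]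

end

end Signing

/-! ### The folding homomorphism -/

namespace BrD6

theorem rel {x y : BrauerFree (Fin 6)}
    (h : BrauerRel graphD6.Adj (fun i j => i ≠ j ∧ ¬ graphD6.Adj i j) brauerDelta x y) :
    RingQuot.mkAlgHom ZDelta (BrauerRel graphD6.Adj (fun i j => i ≠ j ∧ ¬ graphD6.Adj i j)
      brauerDelta) x =
    RingQuot.mkAlgHom ZDelta (BrauerRel graphD6.Adj (fun i j => i ≠ j ∧ ¬ graphD6.Adj i j)
      brauerDelta) y :=
  RingQuot.mkAlgHom_rel ZDelta h

theorem R_sq (i : Fin 6) : R i * R i = 1 := by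
  simpa [R, E, SimplyLacedBrauerAlgebra.R, SimplyLacedBrauerAlgebra.E] using rel (.r_sq i)

theorem R_E (i : Fin 6) : R i * E i = E i := by
  simpa [R, E, SimplyLacedBrauerAlgebra.R, SimplyLacedBrauerAlgebra.E] using rel (.r_e i)

theorem E_R (i : Fin 6) : E i * R i = E i := by
  simpa [R, E, SimplyLacedBrauerAlgebra.R, SimplyLacedBrauerAlgebra.E] using rel (.e_r i)

theorem E_sq (i : Fin 6) : E i * E i = brauerDelta • E i := by
  simpa [R, E, SimplyLacedBrauerAlgebra.R, SimplyLacedBrauerAlgebra.E] using rel (.e_sq i)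

section

variable {i j : Fin 6}

theorem R_comm (h : i ≠ j ∧ ¬ graphD6.Adj i j) : Commute (R i) (R j) := by
  simpa [R, E, SimplyLacedBrauerAlgebra.R, SimplyLacedBrauerAlgebra.E, Commute, SemiconjBy]
    using rel (.r_comm i j h)

theorem E_R_comm (h : i ≠ j ∧ ¬ graphD6.Adj i j) : Commute (E i) (R j) := by
  simpa [R, E, SimplyLacedBrauerAlgebra.R, SimplyLacedBrauerAlgebra.E, Commute, SemiconjBy]
    using rel (.e_r_comm i j h)

theorem E_comm (h : i ≠ j ∧ ¬ graphD6.Adj i j) : Commute (E i) (E j) := by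
  simpa [R, E, SimplyLacedBrauerAlgebra.R, SimplyLacedBrauerAlgebra.E, Commute, SemiconjBy]
    using rel (.e_comm i j h)

theorem R_braid (h : graphD6.Adj i j) : R i * R j * R i = R j * R i * R j := by
  simpa [R, E, SimplyLacedBrauerAlgebra.R, SimplyLacedBrauerAlgebra.E] using rel (.braid i j h)

theorem R_R_E (h : graphD6.Adj i j) : R j * R i * E j = E i * E j := by
  simpa [R, E, SimplyLacedBrauerAlgebra.R, SimplyLacedBrauerAlgebra.E] using rel (.r_r_e i j h)

theorem R_E_R (h : graphD6.Adj i j) : R i * E j * R i = R j * E i * R j := by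
  simpa [R, E, SimplyLacedBrauerAlgebra.R, SimplyLacedBrauerAlgebra.E] using rel (.r_e_r i j h)

theorem semiconj_R_R_E (h : graphD6.Adj i j) : SemiconjBy (R i * R j) (E i) (E j) := by
  have h1 := congrArg (fun x => R i * x * R j) (R_E_R h)
  have hi (x) : R i * (R i * x) = x := by rw [← mul_assoc, R_sq, one_mul]
  simpa only [SemiconjBy, mul_assoc, hi, R_sq, mul_one] using h1.symm

theorem E_R_R (h : graphD6.Adj i j) : E j * R i * R j = E j * E i := by
  rw [mul_assoc, ← (semiconj_R_R_E h).eq, R_R_E h.symm]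

theorem E_R_E (h : graphD6.Adj i j) : E i * R j * E i = E i := by
  have hi (k x) : R k * (R k * x) = x := by rw [← mul_assoc, R_sq, one_mul]
  calc E i * R j * E i = E i * R i * R j * E i := by rw [E_R]
    _ = E i * (R i * R j * E i) := by simp only [mul_assoc]
    _ = (E i * E j) * E i := by rw [R_R_E h.symm, mul_assoc]
    _ = R j * R i * (E j * E i) := by rw [← R_R_E h, mul_assoc]
    _ = E i := by rw [← R_R_E h.symm]; simp only [mul_assoc, hi]

theorem E_E_E (h : graphD6.Adj i j) : E i * E j * E i = E i := by
  have hi (k x) : R k * (R k * x) = x := by rw [← mul_assoc, R_sq, one_mul]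
  rw [← R_R_E h, mul_assoc, ← R_R_E h.symm]
  simp only [mul_assoc, hi]

end

/-- The prescribed images of the generators. -/
noncomputable def foldedGen : BrauerGen (Fin 3) → BrD6
  | .r i => R (![1, 2, 0] i) * R (![3, 4, 5] i)
  | .e i => E (![1, 2, 0] i) * E (![3, 4, 5] i)

/-- Identities in the Coxeter group of the chain of nodes `1, 2, 3, 4`. -/
theorem chain_identities :
    (R 1 * R 3) * (R 2 * R 4) * (R 1 * R 3) * (R 2 * R 4) * (R 1 * R 3) =
      (R 2 * R 4) * (R 1 * R 3) * (R 2 * R 4) * (R 1 * R 3) * (R 2 * R 4) ∧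
    (R 1 * R 3) * (R 2 * R 4) =
      (R 2 * R 4) * (R 1 * R 3) * ((R 3 * R 4) * (R 2 * R 3) * (R 1 * R 2) * (R 3 * R 4)) ∧
    ((R 3 * R 4) * (R 2 * R 3) * (R 1 * R 2) * (R 3 * R 4)) * (R 2 * R 4) * (R 1 * R 3) =
      (R 1 * R 3) * (R 2 * R 4) := by
  have s (i) : R i * R i = 1 := R_sq i
  have s' (i x) : R i * (R i * x) = x := by rw [← mul_assoc, s, one_mul]
  have c31 : R 3 * R 1 = R 1 * R 3 := R_comm (by decide)
  have c41 : R 4 * R 1 = R 1 * R 4 := R_comm (by decide)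
  have c42 : R 4 * R 2 = R 2 * R 4 := R_comm (by decide)
  have b21 : R 2 * (R 1 * R 2) = R 1 * (R 2 * R 1) := by
    simpa only [mul_assoc] using R_braid (show graphD6.Adj 2 1 by decide)
  have b32 : R 3 * (R 2 * R 3) = R 2 * (R 3 * R 2) := by
    simpa only [mul_assoc] using R_braid (show graphD6.Adj 3 2 by decide)
  have b43 : R 4 * (R 3 * R 4) = R 3 * (R 4 * R 3) := by
    simpa only [mul_assoc] using R_braid (show graphD6.Adj 4 3 by decide)
  have c31' (x) : R 3 * (R 1 * x) = R 1 * (R 3 * x) := by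
    simpa only [mul_assoc] using congrArg (· * x) c31
  have c41' (x) : R 4 * (R 1 * x) = R 1 * (R 4 * x) := by
    simpa only [mul_assoc] using congrArg (· * x) c41
  have c42' (x) : R 4 * (R 2 * x) = R 2 * (R 4 * x) := by
    simpa only [mul_assoc] using congrArg (· * x) c42
  have b21' (x) : R 2 * (R 1 * (R 2 * x)) = R 1 * (R 2 * (R 1 * x)) := by
    simpa only [mul_assoc] using congrArg (· * x) b21
  have b32' (x) : R 3 * (R 2 * (R 3 * x)) = R 2 * (R 3 * (R 2 * x)) := by
    simpa only [mul_assoc] using congrArg (· * x) b32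
  have b43' (x) : R 4 * (R 3 * (R 4 * x)) = R 3 * (R 4 * (R 3 * x)) := by
    simpa only [mul_assoc] using congrArg (· * x) b43
  have b321 (x) : R 3 * (R 2 * (R 1 * (R 3 * x))) = R 2 * (R 3 * (R 2 * (R 1 * x))) := by
    rw [← c31', b32']
  have b432 (x) : R 4 * (R 3 * (R 2 * (R 4 * x))) = R 3 * (R 4 * (R 3 * (R 2 * x))) := by
    rw [← c42', b43']
  have b4321 (x) : R 4 * (R 3 * (R 2 * (R 1 * (R 4 * x)))) =
      R 3 * (R 4 * (R 3 * (R 2 * (R 1 * x)))) := by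
    rw [← c41', b432]
  have b321' : R 3 * (R 2 * (R 1 * R 3)) = R 2 * (R 3 * (R 2 * R 1)) := by
    rw [← c31, b32']
  have b4321' : R 4 * (R 3 * (R 2 * (R 1 * R 4))) = R 3 * (R 4 * (R 3 * (R 2 * R 1))) := by
    rw [← c41, b432]
  refine ⟨?_, ?_, ?_⟩
  all_goals simp only [mul_assoc, s, s', mul_one, c41, c31', c41', c42', b21', b32', b321, b321',
    b4321, b4321']

/-- The word carries `E 1` to `E 4` and `E 3` to `E 2`: each factor moves the generator along a bond
or commutes with it, after a regrouping for `E 3`. -/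
theorem semiconj_chain :
    SemiconjBy ((R 3 * R 4) * (R 2 * R 3) * (R 1 * R 2) * (R 3 * R 4)) (E 1 * E 3) (E 2 * E 4) := by
  have h13 : Commute (R 3) (E 1) := (E_R_comm (by decide)).symm
  have h14 : Commute (R 4) (E 1) := (E_R_comm (by decide)).symm
  have h41 : Commute (R 1) (E 4) := (E_R_comm (by decide)).symm
  have h42 : Commute (R 2) (E 4) := (E_R_comm (by decide)).symm
  have r24 : Commute (R 2) (R 4) := R_comm (by decide)
  have h1 : SemiconjBy ((R 3 * R 4) * (R 2 * R 3) * (R 1 * R 2) * (R 3 * R 4)) (E 1) (E 4) :=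
    (((semiconj_R_R_E (by decide)).mul_left (semiconj_R_R_E (by decide))).mul_left
      (semiconj_R_R_E (by decide))).mul_left (h13.mul_left h14)
  have h2 : SemiconjBy ((R 3 * R 4) * (R 2 * R 3) * (R 1 * R 2) * (R 3 * R 4)) (E 3) (E 2) := by
    have e : (R 3 * R 4) * (R 2 * R 3) = (R 3 * R 2) * (R 4 * R 3) := r24.symm.mul_mul_mul_comm _ _
    rw [e]
    exact (((semiconj_R_R_E (by decide)).mul_left (semiconj_R_R_E (by decide))).mul_left
      (h41.mul_left h42)).mul_left (semiconj_R_R_E (by decide))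
  have h24 : Commute (E 4) (E 2) := E_comm (by decide)
  have h := h1.mul_right h2
  rwa [h24.eq] at h

/-- By `chain_identities` the two conjugating words differ by the factor `g` of `semiconj_chain`,
which takes one product of generators to the other. -/
theorem fold_conj5 :
    (R 1 * R 3) * (R 2 * R 4) * (E 1 * E 3) * (R 2 * R 4) * (R 1 * R 3) =
      (R 2 * R 4) * (R 1 * R 3) * (E 2 * E 4) * (R 1 * R 3) * (R 2 * R 4) := by
  obtain ⟨-, h1, h2⟩ := chain_identities
  have h := semiconj_chain.eq
  set g := (R 3 * R 4) * (R 2 * R 3) * (R 1 * R 2) * (R 3 * R 4)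
  calc _ = (R 2 * R 4) * (R 1 * R 3) * (g * (E 1 * E 3)) * (R 2 * R 4) * (R 1 * R 3) := by
        rw [h1]; simp only [mul_assoc]
    _ = (R 2 * R 4) * (R 1 * R 3) * (E 2 * E 4) * (g * (R 2 * R 4) * (R 1 * R 3)) := by
        rw [h]; simp only [mul_assoc]
    _ = _ := by rw [h2]; simp only [mul_assoc]

theorem fold_e_e_e : (E 1 * E 3) * (E 2 * E 4) * (E 1 * E 3) = E 1 * E 3 := by
  have c13 : Commute (E 1) (E 3) := E_comm (by decide)
  have c14 : Commute (E 1) (E 4) := E_comm (by decide)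
  have h1 : E 1 * E 2 * E 1 = E 1 := E_E_E (by decide)
  have h3 : E 3 * E 2 * E 3 = E 3 := E_E_E (by decide)
  have h4 : E 3 * E 4 * E 3 = E 3 := E_E_E (by decide)
  calc (E 1 * E 3) * (E 2 * E 4) * (E 1 * E 3)
      = (E 3 * E 1) * E 2 * (E 4 * E 1) * E 3 := by nth_rw 1 [c13.eq]; simp only [mul_assoc]
    _ = E 3 * (E 1 * E 2 * E 1) * E 4 * E 3 := by rw [← c14.eq]; simp only [mul_assoc]
    _ = (E 3 * E 1) * E 4 * E 3 := by rw [h1]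
    _ = E 1 * (E 3 * E 4 * E 3) := by rw [← c13.eq]; simp only [mul_assoc]
    _ = _ := by rw [h4]

theorem fold_e_r_e : (E 1 * E 3) * (R 2 * R 4) * (E 1 * E 3) = E 1 * E 3 := by
  have c13 : Commute (E 1) (E 3) := E_comm (by decide)
  have c14 : Commute (E 1) (R 4) := E_R_comm (by decide)
  have h1 : E 1 * R 2 * E 1 = E 1 := E_R_E (by decide)
  have h4 : E 3 * R 4 * E 3 = E 3 := E_R_E (by decide)
  calc (E 1 * E 3) * (R 2 * R 4) * (E 1 * E 3)
      = (E 3 * E 1) * R 2 * (R 4 * E 1) * E 3 := by nth_rw 1 [c13.eq]; simp only [mul_assoc]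
    _ = E 3 * (E 1 * R 2 * E 1) * R 4 * E 3 := by rw [← c14.eq]; simp only [mul_assoc]
    _ = (E 3 * E 1) * R 4 * E 3 := by rw [h1]
    _ = E 1 * (E 3 * R 4 * E 3) := by rw [← c13.eq]; simp only [mul_assoc]
    _ = _ := by rw [h4]

theorem fold_e_rrr_e :
    (E 1 * E 3) * (R 2 * R 4) * (R 1 * R 3) * (R 2 * R 4) * (E 1 * E 3) = E 1 * E 3 := by
  have c13 : Commute (E 1) (E 3) := E_comm (by decide)
  have c14 : Commute (E 1) (R 4) := E_R_comm (by decide)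
  have c24 : Commute (E 2) (R 4) := E_R_comm (by decide)
  have r14 : Commute (R 1) (R 4) := R_comm (by decide)
  have r24 : Commute (R 2) (R 4) := R_comm (by decide)
  have h1 : E 1 * R 2 * R 1 = E 1 * E 2 := E_R_R (by decide)
  have h2 : E 2 * R 3 * R 2 = E 2 * E 3 := E_R_R (by decide)
  have h3 : E 1 * E 2 * E 1 = E 1 := E_E_E (by decide)
  have h4 : E 3 * R 4 * E 3 = E 3 := E_R_E (by decide)
  calc (E 1 * E 3) * (R 2 * R 4) * (R 1 * R 3) * (R 2 * R 4) * (E 1 * E 3)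
      = (E 3 * E 1) * R 2 * (R 4 * R 1) * R 3 * (R 2 * R 4) * (E 1 * E 3) := by
        nth_rw 1 [c13.eq]; simp only [mul_assoc]
    _ = E 3 * (E 1 * R 2 * R 1) * R 4 * R 3 * (R 2 * R 4) * (E 1 * E 3) := by
        rw [← r14.eq]; simp only [mul_assoc]
    _ = E 3 * E 1 * (E 2 * R 4) * R 3 * (R 2 * R 4) * (E 1 * E 3) := by
        rw [h1]; simp only [mul_assoc]
    _ = E 3 * (E 1 * R 4) * (E 2 * R 3 * R 2) * (R 4 * E 1) * E 3 := by
        rw [c24.eq]; simp only [mul_assoc]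
    _ = E 3 * (E 1 * R 4) * E 2 * (E 3 * E 1) * (R 4 * E 3) := by
        rw [h2, ← c14.eq]; simp only [mul_assoc]
    _ = E 3 * R 4 * (E 1 * E 2 * E 1) * (E 3 * R 4 * E 3) := by
        rw [c14.eq, ← c13.eq]; simp only [mul_assoc]
    _ = E 3 * R 4 * (E 1 * E 3) := by rw [h3, h4]; simp only [mul_assoc]
    _ = (E 3 * R 4 * E 3) * E 1 := by rw [c13.eq]; simp only [mul_assoc]
    _ = E 1 * E 3 := by rw [h4, c13.eq]

/-- Commuting pairs of bonds fold to a bond. -/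
theorem fold_bond {i j k l : Fin 6} (hij : graphD6.Adj i j) (hkl : graphD6.Adj k l)
    (hik : i ≠ k ∧ ¬ graphD6.Adj i k) (hil : i ≠ l ∧ ¬ graphD6.Adj i l)
    (hjk : j ≠ k ∧ ¬ graphD6.Adj j k) (hjl : j ≠ l ∧ ¬ graphD6.Adj j l) :
    (R i * R k) * (R j * R l) * (R i * R k) = (R j * R l) * (R i * R k) * (R j * R l) ∧
    (R j * R l) * (R i * R k) * (E j * E l) = (E i * E k) * (E j * E l) ∧
    (R i * R k) * (E j * E l) * (R i * R k) = (R j * R l) * (E i * E k) * (R j * R l) := by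
  have swap {a b : Fin 6} (h : a ≠ b ∧ ¬ graphD6.Adj a b) : b ≠ a ∧ ¬ graphD6.Adj b a :=
    ⟨h.1.symm, fun h' => h.2 h'.symm⟩
  have mul3 {a b c a' b' c' : BrD6} (h1 : Commute a' b) (h2 : Commute a' c) (h3 : Commute b' c) :
      (a * a') * (b * b') * (c * c') = (a * b * c) * (a' * b' * c') := by
    rw [h1.mul_mul_mul_comm, (h2.mul_left h3).mul_mul_mul_comm]
  have ki := R_comm (swap hik)
  have kj := R_comm (swap hjk)
  have li := R_comm (swap hil)
  have lj := R_comm (swap hjl)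
  refine ⟨?_, ?_, ?_⟩
  · rw [mul3 kj ki li, mul3 li lj kj, R_braid hij, R_braid hkl]
  · rw [mul3 li (E_R_comm hjl).symm (E_R_comm hjk).symm, R_R_E hij, R_R_E hkl,
      (E_comm (swap hjk)).mul_mul_mul_comm]
  · rw [mul3 (E_R_comm hjk).symm ki (E_R_comm (swap hil)), mul3 (E_R_comm hil).symm lj
      (E_R_comm (swap hjk)), R_E_R hij, R_E_R hkl]

theorem lift_foldedGen_common ⦃x y : BrauerFree (Fin 3)⦄
    (h : BrauerRel (fun i j => coxeterH3 i j = 3) (fun i j => coxeterH3 i j = 2)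
      (brauerDelta ^ 2) x y) :
    FreeAlgebra.lift ZDelta foldedGen x = FreeAlgebra.lift ZDelta foldedGen y := by
  have hab : ∀ i : Fin 3, (![1, 2, 0] i : Fin 6) ≠ ![3, 4, 5] i ∧
      ¬ graphD6.Adj (![1, 2, 0] i) (![3, 4, 5] i) := by decide
  have swap {a b : Fin 6} (h : a ≠ b ∧ ¬ graphD6.Adj a b) : b ≠ a ∧ ¬ graphD6.Adj b a :=
    ⟨h.1.symm, fun h' => h.2 h'.symm⟩
  have two : ∀ i j : Fin 3, coxeterH3 i j = 2 →
      ((![1, 2, 0] i : Fin 6) ≠ ![1, 2, 0] j ∧ ¬ graphD6.Adj (![1, 2, 0] i) (![1, 2, 0] j)) ∧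
      ((![1, 2, 0] i : Fin 6) ≠ ![3, 4, 5] j ∧ ¬ graphD6.Adj (![1, 2, 0] i) (![3, 4, 5] j)) ∧
      ((![3, 4, 5] i : Fin 6) ≠ ![1, 2, 0] j ∧ ¬ graphD6.Adj (![3, 4, 5] i) (![1, 2, 0] j)) ∧
      ((![3, 4, 5] i : Fin 6) ≠ ![3, 4, 5] j ∧ ¬ graphD6.Adj (![3, 4, 5] i) (![3, 4, 5] j)) := by
    intro i j h
    fin_cases i <;> fin_cases j <;> first | exact absurd h (by decide) | decide
  have three : ∀ i j : Fin 3, coxeterH3 i j = 3 →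
      (graphD6.Adj (![1, 2, 0] i) (![1, 2, 0] j) ∧ graphD6.Adj (![3, 4, 5] i) (![3, 4, 5] j)) ∧
      ((![1, 2, 0] i : Fin 6) ≠ ![3, 4, 5] j ∧ ¬ graphD6.Adj (![1, 2, 0] i) (![3, 4, 5] j)) ∧
      ((![1, 2, 0] j : Fin 6) ≠ ![3, 4, 5] i ∧ ¬ graphD6.Adj (![1, 2, 0] j) (![3, 4, 5] i)) := by
    intro i j h
    fin_cases i <;> fin_cases j <;> first | exact absurd h (by decide) | decide
  cases h with
  | r_sq i =>
    have h := R_comm (swap (hab i))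
    simp only [freeR, map_mul, map_one, FreeAlgebra.lift_ι_apply, foldedGen]
    rw [h.mul_mul_mul_comm, R_sq, R_sq, one_mul]
  | r_e i =>
    have h := (E_R_comm (hab i)).symm
    simp only [freeR, freeE, map_mul, FreeAlgebra.lift_ι_apply, foldedGen]
    rw [h.mul_mul_mul_comm, R_E, R_E]
  | e_r i =>
    have h := E_R_comm (swap (hab i))
    simp only [freeR, freeE, map_mul, FreeAlgebra.lift_ι_apply, foldedGen]
    rw [h.mul_mul_mul_comm, E_R, E_R]
  | e_sq i =>
    have h := E_comm (swap (hab i))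
    simp only [freeE, map_mul, map_smul, FreeAlgebra.lift_ι_apply, foldedGen]
    rw [h.mul_mul_mul_comm, E_sq, E_sq, smul_mul_smul_comm, sq]
  | r_comm i j h =>
    obtain ⟨h1, h2, h3, h4⟩ := two i j h
    simp only [freeR, map_mul, FreeAlgebra.lift_ι_apply, foldedGen]
    exact (((R_comm h1).mul_right (R_comm h2)).mul_left ((R_comm h3).mul_right (R_comm h4))).eq
  | e_r_comm i j h =>
    obtain ⟨h1, h2, h3, h4⟩ := two i j h
    simp only [freeR, freeE, map_mul, FreeAlgebra.lift_ι_apply, foldedGen]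
    exact (((E_R_comm h1).mul_right (E_R_comm h2)).mul_left
      ((E_R_comm h3).mul_right (E_R_comm h4))).eq
  | e_comm i j h =>
    obtain ⟨h1, h2, h3, h4⟩ := two i j h
    simp only [freeE, map_mul, FreeAlgebra.lift_ι_apply, foldedGen]
    exact (((E_comm h1).mul_right (E_comm h2)).mul_left ((E_comm h3).mul_right (E_comm h4))).eq
  | braid i j h =>
    obtain ⟨⟨h1, h2⟩, h3, h4⟩ := three i j h
    simp only [freeR, map_mul, FreeAlgebra.lift_ι_apply, foldedGen]
    exact (fold_bond h1 h2 (hab i) h3 h4 (hab j)).1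
  | r_r_e i j h =>
    obtain ⟨⟨h1, h2⟩, h3, h4⟩ := three i j h
    simp only [freeR, freeE, map_mul, FreeAlgebra.lift_ι_apply, foldedGen]
    exact (fold_bond h1 h2 (hab i) h3 h4 (hab j)).2.1
  | r_e_r i j h =>
    obtain ⟨⟨h1, h2⟩, h3, h4⟩ := three i j h
    simp only [freeR, freeE, map_mul, FreeAlgebra.lift_ι_apply, foldedGen]
    exact (fold_bond h1 h2 (hab i) h3 h4 (hab j)).2.2

theorem lift_foldedGen_rel ⦃x y : BrauerFree (Fin 3)⦄ (h : BrH3Rel x y) :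
    FreeAlgebra.lift ZDelta foldedGen x = FreeAlgebra.lift ZDelta foldedGen y := by
  have r0 : foldedGen (.r 0) = R 1 * R 3 := rfl
  have r1 : foldedGen (.r 1) = R 2 * R 4 := rfl
  have e0 : foldedGen (.e 0) = E 1 * E 3 := rfl
  have e1 : foldedGen (.e 1) = E 2 * E 4 := rfl
  cases h with
  | common x y h => exact lift_foldedGen_common h
  | braid5 =>
    simp only [freeR, map_mul, FreeAlgebra.lift_ι_apply, r0, r1]
    exact chain_identities.1
  | conj5 =>
    simp only [freeR, freeE, map_mul, FreeAlgebra.lift_ι_apply, r0, r1, e0, e1]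
    exact fold_conj5
  | e_e_e =>
    simp only [freeE, map_mul, FreeAlgebra.lift_ι_apply, e0, e1]
    exact fold_e_e_e
  | e_r_e =>
    simp only [freeR, freeE, map_mul, FreeAlgebra.lift_ι_apply, r1, e0]
    exact fold_e_r_e
  | e_rrr_e =>
    simp only [freeR, freeE, map_mul, FreeAlgebra.lift_ι_apply, r0, r1, e0]
    exact fold_e_rrr_e

/-- The homomorphism from the Brauer algebra of type `H₃` to that of type `D₆`. -/
noncomputable def fold : BrH3 →ₐ[ZDelta] BrD6 :=
  RingQuot.liftAlgHom ZDelta ⟨FreeAlgebra.lift ZDelta foldedGen, lift_foldedGen_rel⟩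

theorem fold_r (i : Fin 3) : fold (BrH3.r i) = R (![1, 2, 0] i) * R (![3, 4, 5] i) := by
  simp only [fold, BrH3.r, freeR, RingQuot.liftAlgHom_mkAlgHom_apply, FreeAlgebra.lift_ι_apply,
    foldedGen]

theorem fold_e (i : Fin 3) : fold (BrH3.e i) = E (![1, 2, 0] i) * E (![3, 4, 5] i) := by
  simp only [fold, BrH3.e, freeE, RingQuot.liftAlgHom_mkAlgHom_apply, FreeAlgebra.lift_ι_apply,
    foldedGen]

end BrD6

/-! ### Two-row diagrams and the orbit of the identity diagram -/

namespace Signing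

section

variable {K : Type} (S : Signing K)

/-- The signing of `A × K` that acts on the second factor. -/
def prod (A : Type) : Signing (A × K) where
  σ := Equiv.prodCongr (Equiv.refl A) S.σ
  σ_σ x := Prod.ext rfl (S.σ_σ x.2)
  trivial_or_free := S.trivial_or_free.imp (fun h x => Prod.ext rfl (h x.2))
    fun h x h' => h x.2 (congrArg Prod.snd h')

variable {S}

theorem sep_of_fst_ne {A : Type} {x y : A × K} (h : x.1 ≠ y.1) : (S.prod A).Sep x y :=
  ⟨fun h' => h (congrArg Prod.fst h'), fun h' => h (congrArg Prod.fst h' :)⟩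

theorem sep_mk {A : Type} (a : A) {x y : K} (h : S.Sep x y) : (S.prod A).Sep (a, x) (a, y) :=
  ⟨fun h' => h.1 (congrArg Prod.snd h'), fun h' => h.2 (congrArg Prod.snd h')⟩

/-- The action of a signed permutation on one of the two copies of `K` in `Bool × K`. -/
def side (b : Bool) : S.Perms →* (S.prod Bool).Perms where
  toFun w := ⟨Equiv.prodCongrRight fun c => if c = b then w.1 else 1, mem_perms.2 fun x => by
    obtain ⟨c, x⟩ := x
    by_cases h : c = b
    · exact Prod.ext rfl (by simpa [prod, h] using Perms.apply_σ w x)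
    · exact Prod.ext rfl (by simp [prod, h])⟩
  map_one' := Subtype.ext (Equiv.ext fun x => by
    obtain ⟨c, x⟩ := x
    simp)
  map_mul' v w := Subtype.ext (Equiv.ext fun x => by
    obtain ⟨c, x⟩ := x
    by_cases h : c = b <;> simp [h])

theorem side_apply_self (b : Bool) (w : S.Perms) (x : K) : (side b w).1 (b, x) = (b, w.1 x) := by
  simp [side]

theorem side_apply_of_ne {b c : Bool} (h : c ≠ b) (w : S.Perms) (x : K) :
    (side b w).1 (c, x) = (c, x) := by
  simp [side, h]

theorem side_commute (v w : S.Perms) : Commute (side true v) (side false w) := by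
  refine Subtype.ext (Equiv.ext fun x => ?_)
  obtain ⟨_ | _, x⟩ := x <;> simp [side]

/-- The matching of the two copies of `K` with each other. -/
def identityMatching (S : Signing K) : (S.prod Bool).Matching where
  toPerms := ⟨Equiv.prodCongr Equiv.boolNot (Equiv.refl K), mem_perms.2 fun _ => rfl⟩
  mul_self := Subtype.ext (Equiv.ext fun x => Prod.ext (Bool.not_not x.1) rfl)
  sep x := sep_of_fst_ne (Bool.not_ne_self x.1)

/-- A permutation slides along the vertical edges to the other row. Hence right multiplication by
group elements becomes an action on the bottom row. -/
theorem side_smul_identityMatching (w : S.Perms) :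
    side true w • identityMatching S = side false w⁻¹ • identityMatching S := by
  have h : (side false w * side true w) • identityMatching S = identityMatching S := by
    refine smul_eq_of_commute (Subtype.ext (Equiv.ext fun x => ?_))
    obtain ⟨_ | _, x⟩ := x <;> simp [side, identityMatching]
  rw [mul_smul] at h
  rw [map_inv, eq_inv_smul_iff, h]

theorem side_smul_identityMatching_apply (w : S.Perms) (x : K) :
    (side true w • identityMatching S).1.1 (true, w.1 x) = (false, x) := by
  rw [← side_apply_self, smul_apply]
  exact side_apply_of_ne (by decide) w x

theorem side_smul_identityMatching_fst (w : S.Perms) (x : Bool × K) :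
    ((side true w • identityMatching S).1.1 x).1 = !x.1 := rfl

/-- A matching whose horizontal pairs on one side are given by a permutation determines the
conjugacy action on this permutation. -/
theorem conj_eq_of_smul_eq {m m' : (S.prod Bool).Matching} {τ g g' h h' : S.Perms} (b : Bool)
    (hm : ∀ q, m.1.1 (b, q) = (b, τ.1 q) ∨ (τ.1 q = q ∧ (m.1.1 (b, q)).1 ≠ b))
    (hm' : ∀ q, m'.1.1 (b, q) = (b, τ.1 q) ∨ (τ.1 q = q ∧ (m'.1.1 (b, q)).1 ≠ b))
    (he : (side b g * side (!b) h) • m = (side b g' * side (!b) h') • m') :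
    g * τ * g⁻¹ = g' * τ * g'⁻¹ := by
  have key (g h : S.Perms) (m : (S.prod Bool).Matching)
      (hm : ∀ q, m.1.1 (b, q) = (b, τ.1 q) ∨ (τ.1 q = q ∧ (m.1.1 (b, q)).1 ≠ b)) (p : K) :
      ((side b g * side (!b) h) • m).1.1 (b, p) = (b, (g * τ * g⁻¹).1 p) ∨
        ((g * τ * g⁻¹).1 p = p ∧ (((side b g * side (!b) h) • m).1.1 (b, p)).1 ≠ b) := by
    have hA (q : K) : (side b g * side (!b) h).1 (b, q) = (b, g.1 q) := by
      change (side b g).1 ((side (!b) h).1 (b, q)) = _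
      rw [side_apply_of_ne (Bool.not_ne_self b).symm, side_apply_self]
    have hp : g.1 (g⁻¹.1 p) = p := g.1.apply_symm_apply p
    have h1 := smul_apply (side b g * side (!b) h) m (b, g⁻¹.1 p)
    have h2 : (g * τ * g⁻¹).1 p = g.1 (τ.1 (g⁻¹.1 p)) := rfl
    rw [hA, hp] at h1
    rw [h1, h2]
    rcases hm (g⁻¹.1 p) with h3 | ⟨h3, h4⟩
    · left; rw [h3, hA]
    · right; exact ⟨by rw [h3, hp], h4⟩
  refine Subtype.ext (Equiv.ext fun p => ?_)
  have h1 := key g h m hm p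
  have h2 := key g' h' m' hm' p
  rw [he] at h1
  rcases h1 with h1 | ⟨h1, h3⟩ <;> rcases h2 with h2 | ⟨h2, h4⟩
  · exact congrArg Prod.snd (h1.symm.trans h2)
  · exact absurd (congrArg Prod.fst h1) h4
  · exact absurd (congrArg Prod.fst h2) h3
  · exact h1.trans h2.symm

/-- The six points with sign `g`. -/
def point (g : K) (i : Fin 6) : Fin 6 × K := (i, g)

theorem sep_point (S : Signing K) (g : K) (i j : Fin 6) (h : i ≠ j) :
    (S.prod (Fin 6)).Sep (point g i) (point g j) :=
  sep_of_fst_ne h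

theorem sep_top_point (S : Signing K) (g : K) (i j : Fin 6) (h : i ≠ j) :
    ((S.prod (Fin 6)).prod Bool).Sep (true, point g i) (true, point g j) :=
  sep_mk true (sep_point S g i j h)

variable [DecidableEq K]

theorem side_refl (b : Bool) (x y : K) : side b (S.refl x y) = (S.prod Bool).refl (b, x) (b, y) := by
  refine Subtype.ext (Equiv.ext fun z => ?_)
  obtain ⟨c, z⟩ := z
  have hσ (q : K) : (S.prod Bool).σ (b, q) = (b, S.σ q) := rfl
  by_cases h : c = b
  · subst h
    rw [side_apply_self, refl_apply, refl_apply]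
    simp only [reflFun, hσ, Prod.mk.injEq, true_and]
    split_ifs <;> rfl
  · rw [side_apply_of_ne h, refl_apply]
    simp [reflFun, hσ, h]

theorem opR_side_mul_opE (w : S.Perms) (x y : K) :
    opR (side false w) * (S.prod Bool).opE (true, x) (true, y) =
      (S.prod Bool).opE (true, x) (true, y) * opR (side false w) := by
  rw [opR_mul_opE, side_apply_of_ne (by decide), side_apply_of_ne (by decide)]

/-- The signed permutation that belongs to a simple reflection of type `H₃`. -/
def foldPerm (S : Signing K) (g : K) (i : Fin 3) : (S.prod (Fin 6)).Perms :=
  (S.prod (Fin 6)).simpleRefl (point g) (![1, 2, 0] i) *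
    (S.prod (Fin 6)).simpleRefl (point g) (![3, 4, 5] i)

theorem simpleRefl_top (S : Signing K) (g : K) (i : Fin 6) :
    ((S.prod (Fin 6)).prod Bool).simpleRefl (fun i => (true, point g i)) i =
      side true ((S.prod (Fin 6)).simpleRefl (point g) i) := by
  rw [simpleRefl, simpleRefl, side_refl]
  fin_cases i <;> rfl

section

variable {g : K} (hl : coxeterH3.IsLiftable (foldPerm S g))

/-- The homomorphism from the Coxeter group of type `H₃` to the group of signed permutations. -/
noncomputable def act : H3.W →* (S.prod (Fin 6)).Perms :=
  coxeterH3.toCoxeterSystem.lift ⟨foldPerm S g, hl⟩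

theorem act_s (i : Fin 3) : act hl (H3.s i) = foldPerm S g i :=
  coxeterH3.toCoxeterSystem.lift_apply_simple hl i

theorem act_list (l : List (Fin 3)) :
    act hl (l.map H3.s).prod = (l.map (foldPerm S g)).prod := by
  have h : act hl ∘ H3.s = foldPerm S g := funext (act_s hl)
  rw [map_list_prod, List.map_map, h]

/-- The representation of the Brauer algebra of type `H₃` on matchings. -/
noncomputable def foldRep (S : Signing K) (g : K) :
    BrH3 →ₐ[ZDelta] Module.End ZDelta ((S.prod (Fin 6)).prod Bool).Mod :=
  (rep (sep_top_point S g)).comp BrD6.fold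

theorem foldRep_r (i : Fin 3) : foldRep S g (BrH3.r i) = opR (side true (foldPerm S g i)) := by
  rw [foldRep, AlgHom.comp_apply, BrD6.fold_r, map_mul, rep_R, rep_R, opR_mul, simpleRefl_top,
    simpleRefl_top, ← map_mul, foldPerm]

theorem foldRep_ω (w : H3.W) : foldRep S g (BrH3.ω w) = opR (side true (act hl w)) := by
  induction w using H3.induction_left with
  | one => rw [map_one, map_one, map_one, map_one, opR_one]
  | mul i w h => rw [map_mul, map_mul, map_mul, map_mul, h, BrH3.ω_s, foldRep_r, act_s, opR_mul]

/-- The action on the identity matching. -/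
noncomputable def orbitMap (S : Signing K) (g : K) :
    BrH3 →ₗ[ZDelta] ((S.prod (Fin 6)).prod Bool).Mod :=
  (LinearMap.applyₗ (Finsupp.single (identityMatching (S.prod (Fin 6))) 1)).comp
    (foldRep S g).toLinearMap

theorem orbitMap_apply (x : BrH3) : orbitMap S g x =
    foldRep S g x (Finsupp.single (identityMatching (S.prod (Fin 6))) 1) := rfl

theorem orbitMap_ω (w : H3.W) : orbitMap S g (BrH3.ω w) =
    Finsupp.single (side true (act hl w) • identityMatching (S.prod (Fin 6))) 1 := by
  rw [orbitMap_apply, foldRep_ω hl, opR_single]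

/-- The group element is slid to the bottom row and then pulled through `x`, which by `hx` does not
affect that row. -/
theorem orbitMap_mul_ω_inv (x : BrH3) (w : H3.W)
    (hx : Commute (opR (side false (act hl w))) (foldRep S g x)) :
    orbitMap S g (x * BrH3.ω w⁻¹) = opR (side false (act hl w)) (orbitMap S g x) := by
  rw [orbitMap_apply, orbitMap_apply, map_mul, Module.End.mul_apply, ← orbitMap_apply,
    orbitMap_ω hl, side_smul_identityMatching, map_inv (act hl), inv_inv, ← opR_single,
    ← Module.End.mul_apply, ← hx.eq, Module.End.mul_apply]

theorem simpleE_commute (w : (S.prod (Fin 6)).Perms) (i : Fin 6) :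
    Commute (opR (side false w)) (rep (sep_top_point S g) (BrD6.E i)) := by
  rw [rep_E]
  fin_cases i <;> exact opR_side_mul_opE w _ _

include hl in
theorem ω_commute (w : (S.prod (Fin 6)).Perms) (v : H3.W) :
    Commute (opR (side false w)) (foldRep S g (BrH3.ω v)) := by
  rw [foldRep_ω hl]
  change _ * _ = _ * _
  rw [opR_mul, opR_mul, (side_commute _ _).eq]

theorem e_commute (w : (S.prod (Fin 6)).Perms) (i : Fin 3) :
    Commute (opR (side false w)) (foldRep S g (BrH3.e i)) := by
  rw [foldRep, AlgHom.comp_apply, BrD6.fold_e, map_mul]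
  exact (simpleE_commute w _).mul_right (simpleE_commute w _)

/-- The matching that belongs to the product of `e 0` and a group element. -/
def cellMatching (S : Signing K) (g : K) (w : (S.prod (Fin 6)).Perms) :
    ((S.prod (Fin 6)).prod Bool).Matching :=
  join (true, point g 0) (true, point g 1) (join (true, point g 2) (true, point g 3)
    (side true w • identityMatching (S.prod (Fin 6))))

theorem orbitMap_e_mul_ω (w : H3.W) : orbitMap S g (BrH3.e 0 * BrH3.ω w) =
    Finsupp.single (cellMatching S g (act hl w)) 1 := by
  -- All edges are still vertical, so no loop closes and both coefficients are 1.
  have h (i j) : ((S.prod (Fin 6)).prod Bool).Sep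
      ((side true (act hl w) • identityMatching (S.prod (Fin 6))).1.1 (true, point g i))
      (true, point g j) :=
    sep_of_fst_ne (by rw [side_smul_identityMatching_fst]; exact Bool.not_ne_self true)
  have hj := join_apply_of_sep (sep_top_point S g 0 2 (by decide))
    (sep_top_point S g 0 3 (by decide)) (h 0 2) (h 0 3)
  rw [orbitMap_apply, map_mul, Module.End.mul_apply, ← orbitMap_apply, orbitMap_ω hl, foldRep,
    AlgHom.comp_apply, BrD6.fold_e, map_mul, rep_E, rep_E, Module.End.mul_apply]
  change opE _ (true, point g 0) (true, point g 1) (opE _ (true, point g 2) (true, point g 3) _) = _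
  rw [opE_single, opE_single, coef_of_sep (h 2 3), coef_of_sep (by rw [hj]; exact h 0 1), one_mul,
    one_mul, cellMatching]

theorem orbitMap_e_monomial (u n v : H3.W) :
    orbitMap S g (BrH3.ω u * BrH3.e 0 * BrH3.ω n * BrH3.ω v⁻¹) = Finsupp.single
      ((side true (act hl u) * side false (act hl v)) • cellMatching S g (act hl n)) 1 := by
  rw [orbitMap_mul_ω_inv hl, mul_assoc, orbitMap_apply, map_mul, Module.End.mul_apply,
    ← orbitMap_apply, orbitMap_e_mul_ω hl, foldRep_ω hl, opR_single, opR_single, smul_smul,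
    (side_commute _ _).eq]
  rw [map_mul, map_mul]
  exact ((ω_commute hl _ _).mul_right (e_commute _ _)).mul_right (ω_commute hl _ _)

theorem orbitMap_f_monomial (u v : H3.W) :
    orbitMap S g (BrH3.ω u * BrH3.f * BrH3.ω v⁻¹) =
      opR (side true (act hl u) * side false (act hl v)) (orbitMap S g BrH3.f) := by
  rw [orbitMap_mul_ω_inv hl, orbitMap_apply, map_mul, Module.End.mul_apply, ← orbitMap_apply,
    foldRep_ω hl, ← Module.End.mul_apply, opR_mul, (side_commute _ _).eq]
  rw [map_mul, BrH3.f, map_mul]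
  exact (ω_commute hl _ _).mul_right ((e_commute _ _).mul_right (e_commute _ _))

/-- The factors `E 1` and `E 0` of the fork are brought together: their product decides between the
signed and the unsigned model. -/
theorem foldRep_f : foldRep S g BrH3.f = rep (sep_top_point S g) (BrD6.E 3) *
    (rep (sep_top_point S g) (BrD6.E 1) * rep (sep_top_point S g) (BrD6.E 0)) *
    rep (sep_top_point S g) (BrD6.E 5) := by
  have h : BrD6.E 1 * BrD6.E 3 = BrD6.E 3 * BrD6.E 1 := BrD6.E_comm (by decide)
  rw [foldRep, AlgHom.comp_apply, BrH3.f, map_mul, BrD6.fold_e, BrD6.fold_e]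
  change rep _ (BrD6.E 1 * BrD6.E 3 * (BrD6.E 0 * BrD6.E 5)) = _
  rw [h]
  simp only [map_mul, mul_assoc]

end

end

end Signing

/-! ### Finite computations with words -/

namespace H3

/-- Words for the representatives of the cosets of the centralizer of `s 0`. -/
def uWord : Fin 15 → List (Fin 3) :=
  ![[], [1, 0, 2, 1, 0, 1], [1, 0, 1, 2, 0, 1], [1], [0, 1], [2, 1], [0, 2, 1], [1, 0, 1],
    [0, 1, 0, 1], [2, 1, 0, 1], [0, 2, 1, 0, 1], [1, 0, 1, 2, 1, 0, 1], [0, 1, 0, 1, 2, 1, 0, 1],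
    [2, 1, 0, 1, 2, 1, 0, 1], [0, 2, 1, 0, 1, 2, 1, 0, 1]]

/-- Words for the representatives of the cosets of `⟨s 0⟩` in its centralizer. -/
def nWord : Fin 4 → List (Fin 3) :=
  ![[], [2], [1, 0, 1, 0, 2, 1, 0, 1, 0, 2, 1, 0, 1], [2, 1, 0, 1, 0, 2, 1, 0, 1, 0, 2, 1, 0, 1]]

/-- Words for the representatives of the cosets of the stabilizer of a triple of orthogonal
reflections. -/
def vWord : Fin 5 → List (Fin 3) := ![[], [1], [0, 1], [2, 1], [1, 0, 1]]

theorem u_eq (j : Fin 15) : u j = ((uWord j).map s).prod := by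
  fin_cases j <;> simp [u, uWord, p, d, s_inv, mul_assoc]

theorem n_eq (l : Fin 4) : n l = ((nWord l).map s).prod := by
  fin_cases l <;> simp [n, nWord, t_eq]

theorem v_eq (m : Fin 5) : v m = ((vWord m).map s).prod := by
  fin_cases m <;> simp [v, vWord]

end H3

namespace Signing

/-- The free signing of a two-element set. -/
def free : Signing Bool where
  σ := Equiv.boolNot
  σ_σ := Bool.not_not
  trivial_or_free := .inr Bool.not_ne_self

/-- The trivial signing of a one-element set. -/
def trivial : Signing Unit where
  σ := 1
  σ_σ _ := rfl
  trivial_or_free := .inl fun _ => rfl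

instance {K : Type} [Fintype K] [DecidableEq K] (S : Signing K) : DecidableEq S.Perms :=
  inferInstanceAs (DecidableEq (Subgroup.centralizer {S.σ}))

theorem isLiftable_free : coxeterH3.IsLiftable (foldPerm free true) := by
  unfold CoxeterMatrix.IsLiftable
  decide +kernel

theorem isLiftable_trivial : coxeterH3.IsLiftable (foldPerm trivial ()) := by
  unfold CoxeterMatrix.IsLiftable
  decide +kernel

theorem conj_word_injective : ∀ i j : Fin 15,
    ((H3.uWord i).map (foldPerm free true)).prod * foldPerm free true 0 *
        ((H3.uWord i).map (foldPerm free true)).prod⁻¹ =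
      ((H3.uWord j).map (foldPerm free true)).prod * foldPerm free true 0 *
        ((H3.uWord j).map (foldPerm free true)).prod⁻¹ → i = j := by
  decide +kernel

theorem centralizer_word_injective : ∀ (k k' : Fin 2) (l l' : Fin 4),
    foldPerm free true 0 ^ (k : ℕ) * ((H3.nWord l).map (foldPerm free true)).prod =
      foldPerm free true 0 ^ (k' : ℕ) * ((H3.nWord l').map (foldPerm free true)).prod →
    k = k' ∧ l = l' := by
  decide +kernel

/-- The hypothesis of `conj_eq_of_smul_eq` for both rows. The rows have equal horizontal edges
because `n l` commutes with `s 0`. -/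
theorem cellMatching_word_apply : ∀ (l : Fin 4) (b : Bool) (q : Fin 6 × Bool),
    (cellMatching free true ((H3.nWord l).map (foldPerm free true)).prod).1.1 (b, q) =
        (b, (foldPerm free true 0).1 q) ∨
      ((foldPerm free true 0).1 q = q ∧
        ((cellMatching free true ((H3.nWord l).map (foldPerm free true)).prod).1.1 (b, q)).1 ≠ b) := by
  decide +kernel

theorem cellMatching_word_injective : ∀ l l' : Fin 4,
    (cellMatching free true ((H3.nWord l).map (foldPerm free true)).prod).1 =
      (cellMatching free true ((H3.nWord l').map (foldPerm free true)).prod).1 → l = l' := by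
  decide +kernel

/-- The matching that belongs to the product of `e 0` and `e 2`. -/
def tripleMatching : ((trivial.prod (Fin 6)).prod Bool).Matching :=
  join (true, point () 2) (true, point () 3) (join (true, point () 0) (true, point () 1)
    (join (true, point () 4) (true, point () 5) (identityMatching (trivial.prod (Fin 6)))))

/-- The permutation of the six points that belongs to a triple of orthogonal reflections. -/
def triplePerm : (trivial.prod (Fin 6)).Perms :=
  (trivial.prod (Fin 6)).refl (point () 0) (point () 1) *
    (trivial.prod (Fin 6)).refl (point () 2) (point () 3) *
    (trivial.prod (Fin 6)).refl (point () 4) (point () 5)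

theorem tripleMatching_apply : ∀ (b : Bool) (q : Fin 6 × Unit),
    tripleMatching.1.1 (b, q) = (b, triplePerm.1 q) := by
  decide +kernel

theorem conj_triple_injective : ∀ i j : Fin 5,
    ((H3.vWord i).map (foldPerm trivial ())).prod * triplePerm *
        ((H3.vWord i).map (foldPerm trivial ())).prod⁻¹ =
      ((H3.vWord j).map (foldPerm trivial ())).prod * triplePerm *
        ((H3.vWord j).map (foldPerm trivial ())).prod⁻¹ → i = j := by
  decide +kernel

theorem orbitMap_free_f : orbitMap free true BrH3.f = 0 := by
  have h : ((free.prod (Fin 6)).prod Bool).opE (true, point true 0) (true, point true 1) *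
      ((free.prod (Fin 6)).prod Bool).opE (true, (free.prod (Fin 6)).σ (point true 0))
        (true, point true 1) = 0 := by
    have h1 := sep_top_point free true 0 1 (by decide)
    have h2 := opE_mul_opE_σ h1.symm (by decide)
    rwa [← opE_symm h1, ← opE_symm h1.left] at h2
  rw [orbitMap_apply, foldRep_f]
  have h' : rep (sep_top_point free true) (BrD6.E 1) * rep (sep_top_point free true) (BrD6.E 0) = 0 := by
    rw [rep_E, rep_E]
    exact h
  rw [h', mul_zero, zero_mul, LinearMap.zero_apply]

/-- Without signs `E 0` and `E 1` act by the same operator; its repetition closes the only loop. -/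
theorem orbitMap_trivial_f : orbitMap trivial () BrH3.f =
    Finsupp.single tripleMatching brauerDelta := by
  have h5 : ((trivial.prod (Fin 6)).prod Bool).Sep
      ((identityMatching (trivial.prod (Fin 6))).1.1 (true, point () 4)) (true, point () 5) :=
    ⟨by decide, by decide⟩
  have h0 : ((trivial.prod (Fin 6)).prod Bool).Sep
      ((join (true, point () 4) (true, point () 5)
        (identityMatching (trivial.prod (Fin 6)))).1.1 (true, point () 0)) (true, point () 1) :=
    ⟨by decide +kernel, by decide +kernel⟩
  have h1 := join_apply (sep_top_point trivial () 0 1 (by decide))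
    (join (true, point () 4) (true, point () 5) (identityMatching (trivial.prod (Fin 6))))
  have h3 : ((trivial.prod (Fin 6)).prod Bool).Sep
      ((join (true, point () 0) (true, point () 1) (join (true, point () 4) (true, point () 5)
        (identityMatching (trivial.prod (Fin 6))))).1.1 (true, point () 2)) (true, point () 3) :=
    ⟨by decide +kernel, by decide +kernel⟩
  rw [orbitMap_apply, foldRep_f, rep_E, rep_E, rep_E, rep_E]
  change opE _ (true, point () 2) (true, point () 3) (opE _ (true, point () 0) (true, point () 1)
    (opE _ (true, point () 0) (true, point () 1) (opE _ (true, point () 4) (true, point () 5) _))) = _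
  rw [opE_single, opE_single, opE_single, opE_single, coef_of_sep h5, coef_of_sep h0,
    coef_of_eq h1, join_of_apply_eq h1, coef_of_sep h3, tripleMatching]
  simp only [one_mul, mul_one]

end Signing

/-! ### Linear independence and the basis -/

namespace BrH3

open Signing

/-- The matchings that belong to the monomials that do not contain `f`. -/
noncomputable def monomialMatching :
    ((Fin 15 × Fin 2 × Fin 4) ⊕ (Fin 15 × Fin 4 × Fin 15)) →
      ((free.prod (Fin 6)).prod Bool).Matching :=
  Sum.elim
    (fun x => side true (act isLiftable_free (H3.u x.1 * (H3.s 0 ^ (x.2.1 : ℕ) * H3.n x.2.2))) •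
      identityMatching (free.prod (Fin 6)))
    (fun x => (side true (act isLiftable_free (H3.u x.1)) *
      side false (act isLiftable_free (H3.u x.2.2))) •
        cellMatching free true (act isLiftable_free (H3.n x.2.1)))

theorem orbitMap_monomial_inl (x) :
    orbitMap free true (monomial (.inl x)) = Finsupp.single (monomialMatching x) 1 := by
  rcases x with x | x
  · exact orbitMap_ω isLiftable_free _
  · exact orbitMap_e_monomial isLiftable_free _ _ _

theorem orbitMap_monomial_inr (x) : orbitMap free true (monomial (.inr x)) = 0 := by
  change orbitMap free true (ω (H3.v x.1) * f * ω (H3.v x.2)⁻¹) = 0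
  rw [orbitMap_f_monomial isLiftable_free, orbitMap_free_f, map_zero]

theorem act_u_conj_injective {i j : Fin 15}
    (h : act isLiftable_free (H3.u i) * foldPerm free true 0 * (act isLiftable_free (H3.u i))⁻¹ =
      act isLiftable_free (H3.u j) * foldPerm free true 0 * (act isLiftable_free (H3.u j))⁻¹) :
    i = j := by
  rw [H3.u_eq, H3.u_eq, act_list, act_list] at h
  exact conj_word_injective i j h

theorem act_u_mul_injective {x y : Fin 15 × Fin 2 × Fin 4}
    (h : act isLiftable_free (H3.u x.1 * (H3.s 0 ^ (x.2.1 : ℕ) * H3.n x.2.2)) =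
      act isLiftable_free (H3.u y.1 * (H3.s 0 ^ (y.2.1 : ℕ) * H3.n y.2.2))) : x = y := by
  obtain ⟨i, k, l⟩ := x
  obtain ⟨i', k', l'⟩ := y
  have hc (k : Fin 2) (l : Fin 4) : H3.s 0 ^ (k : ℕ) * H3.n l * H3.s 0 *
      (H3.s 0 ^ (k : ℕ) * H3.n l)⁻¹ = H3.s 0 := by
    have h' : Commute (H3.s 0 ^ (k : ℕ) * H3.n l) (H3.s 0) :=
      ((Commute.refl _).pow_left _).mul_left (H3.n_comm_zero l)
    rw [h'.eq, mul_inv_cancel_right]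
  have hconj (i : Fin 15) (k : Fin 2) (l : Fin 4) : act isLiftable_free (H3.u i * (H3.s 0 ^ (k : ℕ) * H3.n l)) *
      foldPerm free true 0 * (act isLiftable_free (H3.u i * (H3.s 0 ^ (k : ℕ) * H3.n l)))⁻¹ =
      act isLiftable_free (H3.u i) * foldPerm free true 0 *
        (act isLiftable_free (H3.u i))⁻¹ := by
    rw [← act_s isLiftable_free 0, ← map_inv, ← map_inv, ← map_mul, ← map_mul, ← map_mul, ← map_mul]
    refine congrArg _ ?_
    conv_rhs => rw [← hc k l]
    simp only [mul_inv_rev, mul_assoc]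
  -- The conjugate of `s 0` depends only on `i`, the other factors lying in its centralizer.
  obtain rfl : i = i' := act_u_conj_injective (by rw [← hconj i k l, h, hconj])
  simp only [map_mul, map_pow, mul_right_inj, act_s] at h
  rw [H3.n_eq, H3.n_eq, act_list, act_list] at h
  obtain ⟨rfl, rfl⟩ := centralizer_word_injective k k' l l' h
  rfl

theorem monomialMatching_injective : Function.Injective monomialMatching := by
  have hcell (l : Fin 4) (b : Bool) (q : Fin 6 × Bool) :
      (cellMatching free true (act isLiftable_free (H3.n l))).1.1 (b, q) =
        (b, (foldPerm free true 0).1 q) ∨ ((foldPerm free true 0).1 q = q ∧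
        ((cellMatching free true (act isLiftable_free (H3.n l))).1.1 (b, q)).1 ≠ b) := by
    rw [H3.n_eq, act_list]
    exact cellMatching_word_apply l b q
  -- Group elements give vertical edges only, whereas `e 0` leaves a horizontal edge at the image of
  -- point 0.
  have hne (x y) : monomialMatching (.inl x) ≠ monomialMatching (.inr y) := by
    intro h
    set g := act isLiftable_free (H3.u y.1)
    have h1 := smul_apply (side true g * side false (act isLiftable_free (H3.u y.2.2)))
      (cellMatching free true (act isLiftable_free (H3.n y.2.1))) (true, point true 0)
    have h2 := congrArg (fun m => (m.1.1 ((side true g * side false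
      (act isLiftable_free (H3.u y.2.2))).1 (true, point true 0))).1) h
    have h3 : (cellMatching free true (act isLiftable_free (H3.n y.2.1))).1.1
        (true, point true 0) = (true, (foldPerm free true 0).1 (point true 0)) :=
      (hcell y.2.1 true _).resolve_right fun h => absurd h.1 (by decide)
    change false = (((side true g * side false (act isLiftable_free (H3.u y.2.2))) •
      cellMatching free true (act isLiftable_free (H3.n y.2.1))).1.1 _).1 at h2
    rw [h1, h3] at h2
    exact absurd h2 (by change false ≠ true; decide)
  rintro (x | x) (y | y) h
  · congr 1
    apply act_u_mul_injective
    refine Subtype.ext (Equiv.ext fun q => ?_)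
    set w := act isLiftable_free (H3.u x.1 * (H3.s 0 ^ (x.2.1 : ℕ) * H3.n x.2.2))
    set w' := act isLiftable_free (H3.u y.1 * (H3.s 0 ^ (y.2.1 : ℕ) * H3.n y.2.2))
    have h1 := side_smul_identityMatching_apply w q
    have h2 := side_smul_identityMatching_apply w' q
    have h3 : side true w • identityMatching (free.prod (Fin 6)) =
      side true w' • identityMatching (free.prod (Fin 6)) := h
    rw [← h3, ← h1] at h2
    exact (congrArg Prod.snd (Equiv.injective _ h2)).symm
  · exact absurd h (hne x y)
  · exact absurd h.symm (hne y x)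
  · obtain ⟨i, l, j⟩ := x
    obtain ⟨i', l', j'⟩ := y
    change (side true (act isLiftable_free (H3.u i)) *
      side false (act isLiftable_free (H3.u j))) •
        cellMatching free true (act isLiftable_free (H3.n l)) =
      (side true (act isLiftable_free (H3.u i')) *
      side false (act isLiftable_free (H3.u j'))) •
        cellMatching free true (act isLiftable_free (H3.n l')) at h
    -- The horizontal edges of the top row determine `i`, those of the bottom row `j`; cancelling
    -- both actions leaves `l`.
    obtain rfl : i = i' := act_u_conj_injective
      (conj_eq_of_smul_eq true (hcell l true) (hcell l' true) h)
    obtain rfl : j = j' := act_u_conj_injective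
      (conj_eq_of_smul_eq false (hcell l false) (hcell l' false)
        (by rw [(side_commute _ _).eq, (side_commute _ _).eq] at h; exact h))
    rw [smul_left_cancel_iff, H3.n_eq, H3.n_eq, act_list, act_list] at h
    obtain rfl := cellMatching_word_injective l l' (congrArg Matching.toPerms h)
    rfl

/-- The matchings that belong to the monomials that contain `f`. -/
noncomputable def tripleMonomialMatching (x : Fin 5 × Fin 5) :
    ((trivial.prod (Fin 6)).prod Bool).Matching :=
  (side true (act isLiftable_trivial (H3.v x.1)) *
    side false (act isLiftable_trivial (H3.v x.2))) • tripleMatching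

theorem orbitMap_trivial_monomial_inr (x) : orbitMap trivial () (monomial (.inr x)) =
    Finsupp.single (tripleMonomialMatching x) brauerDelta := by
  change orbitMap trivial () (ω (H3.v x.1) * f * ω (H3.v x.2)⁻¹) = _
  rw [orbitMap_f_monomial isLiftable_trivial, orbitMap_trivial_f, opR_single,
    tripleMonomialMatching]

theorem tripleMonomialMatching_injective : Function.Injective tripleMonomialMatching := by
  have hinj {i j : Fin 5} (h : act isLiftable_trivial (H3.v i) * triplePerm *
      (act isLiftable_trivial (H3.v i))⁻¹ = act isLiftable_trivial (H3.v j) * triplePerm *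
      (act isLiftable_trivial (H3.v j))⁻¹) : i = j := by
    rw [H3.v_eq, H3.v_eq, act_list, act_list] at h
    exact conj_triple_injective i j h
  have ht (b : Bool) (q : Fin 6 × Unit) : tripleMatching.1.1 (b, q) = (b, triplePerm.1 q) ∨
      (triplePerm.1 q = q ∧ (tripleMatching.1.1 (b, q)).1 ≠ b) :=
    .inl (tripleMatching_apply b q)
  intro x y h
  have h' := h
  simp only [tripleMonomialMatching, (side_commute _ _).eq] at h'
  exact Prod.ext (hinj (conj_eq_of_smul_eq true (ht true) (ht true) h))
    (hinj (conj_eq_of_smul_eq false (ht false) (ht false) h'))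

/-- Block triangularity: the second family lies in the kernel of `f`, which the span of the first
meets only in zero. -/
theorem linearIndependent_of_map_inl_of_map_inr {ι κ R M N P : Type*} [Ring R] [AddCommMonoid M]
    [AddCommGroup N] [AddCommGroup P] [Module R M] [Module R N] [Module R P] {v : ι ⊕ κ → M}
    (f : M →ₗ[R] N) (g : M →ₗ[R] P) (hf : LinearIndependent R (f ∘ v ∘ Sum.inl))
    (hg : LinearIndependent R (g ∘ v ∘ Sum.inr)) (h : ∀ x, f (v (.inr x)) = 0) :
    LinearIndependent R v := by
  let _ : AddCommGroup M := Module.addCommMonoidToAddCommGroup R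
  refine linearIndependent_sum.2 ⟨hf.of_comp _, hg.of_comp _, ?_⟩
  refine (Submodule.range_ker_disjoint hf).mono_right (Submodule.span_le.2 ?_)
  rintro _ ⟨x, rfl⟩
  exact h x

theorem injective_of_linearIndependent_comp_basis {ι R M N : Type*} [Ring R] [AddCommMonoid M]
    [AddCommMonoid N] [Module R M] [Module R N] (b : Module.Basis ι R M) (f : M →ₗ[R] N)
    (h : LinearIndependent R (f ∘ b)) : Function.Injective f := by
  let _ : AddCommGroup M := Module.addCommMonoidToAddCommGroup R
  let _ : AddCommGroup N := Module.addCommMonoidToAddCommGroup R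
  have h' := Submodule.range_ker_disjoint h
  rw [b.span_eq, top_disjoint] at h'
  exact LinearMap.ker_eq_bot.1 h'

/-- The action of the Brauer algebra of type `D₆` on the identity matching. -/
noncomputable def identityOrbit {K : Type} [DecidableEq K] (S : Signing K) (g : K) :
    BrD6 →ₗ[ZDelta] ((S.prod (Fin 6)).prod Bool).Mod :=
  (LinearMap.applyₗ (Finsupp.single (identityMatching (S.prod (Fin 6))) 1)).comp
    (rep (sep_top_point S g)).toLinearMap

theorem identityOrbit_fold {K : Type} [DecidableEq K] (S : Signing K) (g : K) (x : BrH3) :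
    identityOrbit S g (BrD6.fold x) = orbitMap S g x := rfl

theorem linearIndependent_inl : LinearIndependent ZDelta
    (identityOrbit free true ∘ (BrD6.fold.toLinearMap ∘ monomial) ∘ Sum.inl) := by
  have h : identityOrbit free true ∘ (BrD6.fold.toLinearMap ∘ monomial) ∘ Sum.inl =
      Finsupp.basisSingleOne (R := ZDelta) ∘ monomialMatching := by
    funext x
    simp only [Function.comp_apply, AlgHom.toLinearMap_apply, identityOrbit_fold,
      orbitMap_monomial_inl, Finsupp.coe_basisSingleOne]
  rw [h]
  exact (Finsupp.basisSingleOne (R := ZDelta)).linearIndependent.comp _ monomialMatching_injective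

theorem linearIndependent_inr : LinearIndependent ZDelta
    (identityOrbit trivial () ∘ (BrD6.fold.toLinearMap ∘ monomial) ∘ Sum.inr) := by
  -- The images are basis vectors scaled by the unit `δ`.
  have hδ : IsUnit brauerDelta := LaurentPolynomial.isUnit_T 1
  have h : identityOrbit trivial () ∘ (BrD6.fold.toLinearMap ∘ monomial) ∘ Sum.inr =
      (fun _ : Fin 5 × Fin 5 => hδ.unit) • (Finsupp.basisSingleOne (R := ZDelta) ∘ tripleMonomialMatching) := by
    funext x
    simp only [Function.comp_apply, AlgHom.toLinearMap_apply, identityOrbit_fold,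
      orbitMap_trivial_monomial_inr, Finsupp.coe_basisSingleOne, Pi.smul_apply', Units.smul_def,
      IsUnit.unit_spec, Finsupp.smul_single, smul_eq_mul, mul_one]
  rw [h]
  exact ((Finsupp.basisSingleOne (R := ZDelta)).linearIndependent.comp _
    tripleMonomialMatching_injective).units_smul _

theorem linearIndependent_fold_monomial :
    LinearIndependent ZDelta (BrD6.fold.toLinearMap ∘ monomial) := by
  refine linearIndependent_of_map_inl_of_map_inr (identityOrbit free true)
    (identityOrbit trivial ()) linearIndependent_inl linearIndependent_inr fun x => ?_
  rw [Function.comp_apply, AlgHom.toLinearMap_apply, identityOrbit_fold, orbitMap_monomial_inr]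

/-- The basis of the Brauer algebra of type `H₃`. -/
noncomputable def basis : Module.Basis Index ZDelta BrH3 :=
  .mk (.of_comp BrD6.fold.toLinearMap linearIndependent_fold_monomial) span_monomial.ge

theorem fold_injective : Function.Injective BrD6.fold := by
  refine injective_of_linearIndependent_comp_basis basis BrD6.fold.toLinearMap ?_
  rw [basis, Module.Basis.coe_mk]
  exact linearIndependent_fold_monomial

end BrH3

theorem theorem1 :
    (∃ φ : BrH3 →ₐ[ZDelta] BrD6,
      HasPrescribedImages φ ∧
      (∀ ψ : BrH3 →ₐ[ZDelta] BrD6, HasPrescribedImages ψ → ψ = φ) ∧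
      Function.Injective φ) ∧
    Module.Free ZDelta BrH3 ∧ Module.rank ZDelta BrH3 = 1045 := by
  have hf : HasPrescribedImages BrD6.fold :=
    ⟨BrD6.fold_r 0, BrD6.fold_r 1, BrD6.fold_r 2, BrD6.fold_e 0, BrD6.fold_e 1, BrD6.fold_e 2⟩
  refine ⟨⟨BrD6.fold, hf, fun ψ hψ => ?_, BrH3.fold_injective⟩, .of_basis BrH3.basis, ?_⟩
  · obtain ⟨r0, r1, r2, e0, e1, e2⟩ := hf
    obtain ⟨r0', r1', r2', e0', e1', e2'⟩ := hψ
    apply BrH3.algHom_ext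
    · intro i
      fin_cases i
      exacts [r0'.trans r0.symm, r1'.trans r1.symm, r2'.trans r2.symm]
    · intro i
      fin_cases i
      exacts [e0'.trans e0.symm, e1'.trans e1.symm, e2'.trans e2.symm]
  -- The index type has 15·2·4 + 15·4·15 + 5·5 = 120 + 900 + 25 elements.
  · rw [rank_eq_card_basis BrH3.basis]
    simp [BrH3.Index]
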